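/- An $(a,b)$-module is a free $\mathbb{C}[[b]]$-module $E$ of finite rank with a $\mathbb{C}$-linear endomorphism $a$ such that $ab-ba=b^2$. Sub-$(a,b)$-modules are the $\mathbb{C}[[b]]$-submodules stable under $a$; such an $F\subseteq E$ is normal if $E/F$ is free over $\mathbb{C}[[b]]$. $E$ is regular if it embeds, as a sub-$(a,b)$-module, into an $(a,b)$-module $M$ with $aM\subseteq bM$. For $\lambda\in\mathbb{C}$, $E_\lambda=\mathbb{C}[[b]]e_\lambda$ is the free module of rank one with $ae_\lambda=\lambda be_\lambda$. The dual of $E$ is $E^*=\mathrm{Hom}_{\mathbb{C}[[b]]}(E,E_0)$ with $(a\varphi)(x)=a\varphi(x)-\varphi(ax)$; the conjugate $\breve E$ is the set $E$ on which $a$ and $b$ act as $-a$ and $-b$; the adjoint of $E$ is the conjugate of $E^*$, and $E$ is self-adjoint if it is isomorphic to its adjoint. A hermitian (respectively anti-hermitian) form on $E$ is a $\mathbb{C}[[b]]$-bilinear map $\Phi:E\times\breve E\to E_0$ with $a\Phi(v,w)=\Phi(a\cdot_E v,w)+\Phi(v,a\cdot_{\breve E}w)$ for all $v,w$, and such that $\Phi(v,w)=S(b)e_0$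 implies $\Phi(w,v)=S(-b)e_0$ (respectively $\Phi(w,v)=-S(-b)e_0$). It is non-degenerate if $v\mapsto\Phi(v,\cdot)$ is an isomorphism $E\to(\breve E)^*$. $E$ is hermitian (respectively anti-hermitian) if it admits a non-degenerate hermitian (respectively anti-hermitian) form. Theorem. Let $E$ be a regular $(a,b)$-module of rank $n$ which is hermitian. Then $E$ has a self-adjoint Jordan–Hölder series, that is, there are normal sub-$(a,b)$-modules $0=F_0\subsetneq F_1\subsetneq\dots\subsetneq F_n=E$ and complex numbers $\lambda_1,\dots,\lambda_n$ with $F_j/F_{j-1}\simeq E_{\lambda_j}$ and $\lambda_{n-j+1}=-\lambda_j$ for all $1\le j\le n$, and such that $F_{n-j}/F_j$ is self-adjoint for all $0\le j\le\lfloor n/2\rfloor$. The same conclusion holds for every regular anti-hermitian $(a,b)$-module $E$. -/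

import Mathlib

open scoped PowerSeries

namespace AB

/-- The `(a,b)`-structure on a `ℂ⟦b⟧`-module: the variable `b` is `PowerSeries.X`, and `a` is a
`ℂ`-linear endomorphism with `ab - ba = b ^ 2`. An `(a,b)`-module is a module with this structure
which is moreover free of finite rank over `ℂ⟦b⟧` (`Module.Free` and `Module.Finite`); quotients of
`(a,b)`-modules carry the structure without being free in general. -/
class ABStructure (E : Type*) [AddCommGroup E] [Module ℂ⟦X⟧ E] where
  /-- the operator `a` -/
  a : E →+ E
  a_const_smul : ∀ (c : ℂ) (x : E),
    a ((PowerSeries.C c : ℂ⟦X⟧) • x) = (PowerSeries.C c : ℂ⟦X⟧) • a x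
  a_b_sub_b_a : ∀ x : E, a ((PowerSeries.X : ℂ⟦X⟧) • x) - (PowerSeries.X : ℂ⟦X⟧) • a x =
    (PowerSeries.X ^ 2 : ℂ⟦X⟧) • x

open ABStructure (a)

/-- `E` and `F` are isomorphic: there is a `ℂ⟦b⟧`-linear bijection commuting with `a`. -/
def IsIso (E F : Type*) [AddCommGroup E] [Module ℂ⟦X⟧ E] [ABStructure E]
    [AddCommGroup F] [Module ℂ⟦X⟧ F] [ABStructure F] : Prop :=
  ∃ f : E ≃ₗ[ℂ⟦X⟧] F, ∀ x : E, f (a x) = a (f x)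

/-! ### Elementary modules -/

/-- The elementary `(a,b)`-module `E_l` of parameter `l`: the free `ℂ⟦b⟧`-module with generator
`e_l = 1` and `a e_l = l b e_l`, so that `a (S e_l) = (l b S + b ^ 2 S') e_l`. -/
def Elem (_l : ℂ) : Type := ℂ⟦X⟧

noncomputable instance (l : ℂ) : AddCommGroup (Elem l) := inferInstanceAs (AddCommGroup ℂ⟦X⟧)

noncomputable instance (l : ℂ) : Module ℂ⟦X⟧ (Elem l) := inferInstanceAs (Module ℂ⟦X⟧ ℂ⟦X⟧)

/-- The coordinate `S` of an element `S e_l` of `E_l`. -/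
noncomputable def Elem.series (l : ℂ) : Elem l ≃ₗ[ℂ⟦X⟧] ℂ⟦X⟧ := LinearEquiv.refl ℂ⟦X⟧ ℂ⟦X⟧

noncomputable instance (l : ℂ) : ABStructure (Elem l) where
  a := AddMonoidHom.mk' (fun s => (Elem.series l).symm
      (PowerSeries.C l * PowerSeries.X * Elem.series l s +
        PowerSeries.X ^ 2 * PowerSeries.derivative ℂ (Elem.series l s))) (by
    intro s t
    rw [← map_add]
    congr 1
    simp only [map_add]
    ring)
  a_const_smul c s := by
    apply (Elem.series l).injective
    simp only [AddMonoidHom.mk'_apply, map_smul, LinearEquiv.apply_symm_apply, smul_eq_mul,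
      Derivation.leibniz, PowerSeries.derivative_C]
    ring
  a_b_sub_b_a s := by
    apply (Elem.series l).injective
    simp only [AddMonoidHom.mk'_apply, map_sub, map_smul, LinearEquiv.apply_symm_apply,
      smul_eq_mul, Derivation.leibniz, PowerSeries.derivative_X]
    ring

theorem series_a (l : ℂ) (s : Elem l) : Elem.series l (a s) =
    PowerSeries.C l * PowerSeries.X * Elem.series l s +
      PowerSeries.X ^ 2 * PowerSeries.derivative ℂ (Elem.series l s) := rfl

/-! ### Sub-`(a,b)`-modules and quotients -/

/-- A sub-`(a,b)`-module: a `ℂ⟦b⟧`-submodule stable under `a`. -/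
structure ABSubmodule (E : Type*) [AddCommGroup E] [Module ℂ⟦X⟧ E] [ABStructure E] extends
    Submodule ℂ⟦X⟧ E where
  a_mem : ∀ x ∈ toSubmodule, a x ∈ toSubmodule

section Sub

variable {E : Type*} [AddCommGroup E] [Module ℂ⟦X⟧ E] [ABStructure E]

noncomputable instance (F : ABSubmodule E) : ABStructure F.toSubmodule where
  a := AddMonoidHom.mk' (fun x => ⟨a (x : E), F.a_mem x x.2⟩) (fun x y => by
    ext
    simp)
  a_const_smul c x := by
    ext
    exact ABStructure.a_const_smul c (x : E)
  a_b_sub_b_a x := by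
    ext
    exact ABStructure.a_b_sub_b_a (x : E)

noncomputable instance (F : ABSubmodule E) : ABStructure (E ⧸ F.toSubmodule) where
  a := QuotientAddGroup.map F.toSubmodule.toAddSubgroup F.toSubmodule.toAddSubgroup a F.a_mem
  a_const_smul c x := by
    obtain ⟨y, rfl⟩ := F.toSubmodule.mkQ_surjective x
    exact congrArg F.toSubmodule.mkQ (ABStructure.a_const_smul c y)
  a_b_sub_b_a x := by
    obtain ⟨y, rfl⟩ := F.toSubmodule.mkQ_surjective x
    exact congrArg F.toSubmodule.mkQ (ABStructure.a_b_sub_b_a y)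

/-- `F` is normal in `E` if `E / F` is free over `ℂ⟦b⟧`. -/
def ABSubmodule.IsNormal (F : ABSubmodule E) : Prop := Module.Free ℂ⟦X⟧ (E ⧸ F.toSubmodule)

/-- `F ∩ G` as a sub-`(a,b)`-module of `G`; this is `F` itself when `F ⊆ G`. -/
noncomputable def ABSubmodule.within (F G : ABSubmodule E) : ABSubmodule G.toSubmodule where
  toSubmodule := F.toSubmodule.submoduleOf G.toSubmodule
  a_mem x hx := F.a_mem (x : E) hx

/-- The quotient `G / F` of two sub-`(a,b)`-modules `F ⊆ G` of `E`. -/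
abbrev Subquotient (G F : ABSubmodule E) : Type _ := G.toSubmodule ⧸ (F.within G).toSubmodule

end Sub

/-! ### Dual, conjugate, adjoint -/

section Dual

variable {E : Type*} [AddCommGroup E] [Module ℂ⟦X⟧ E] [ABStructure E]

/-- For `φ` with values in `E_0`, the `ℂ`-linear map `x ↦ a φ(x) - φ(a x)` is `ℂ⟦b⟧`-linear. -/
theorem dual_aux (φ : E →ₗ[ℂ⟦X⟧] Elem 0) (s : ℂ⟦X⟧) (x : E) :
    a (φ (s • x)) - φ (a (s • x)) = s • (a (φ x) - φ (a x)) := by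
  have key : ∀ (N : ℕ) (s : ℂ⟦X⟧), PowerSeries.X ^ N ∣
      Elem.series 0 (a (φ (s • x)) - φ (a (s • x)) - s • (a (φ x) - φ (a x))) := by
    intro N
    induction N with
    | zero => intro s; simp
    | succ N ih =>
      intro s
      obtain ⟨t, c, rfl⟩ : ∃ (t : ℂ⟦X⟧) (c : ℂ), s = PowerSeries.X * t + PowerSeries.C c :=
        ⟨_, _, PowerSeries.eq_X_mul_shift_add_const s⟩
      have h1 : ∀ y : E, a ((PowerSeries.X : ℂ⟦X⟧) • y) =
          (PowerSeries.X : ℂ⟦X⟧) • a y + (PowerSeries.X ^ 2 : ℂ⟦X⟧) • y := fun y => by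
        rw [← ABStructure.a_b_sub_b_a y]; abel
      have h2 : ∀ y : Elem 0, a ((PowerSeries.X : ℂ⟦X⟧) • y) =
          (PowerSeries.X : ℂ⟦X⟧) • a y + (PowerSeries.X ^ 2 : ℂ⟦X⟧) • y := fun y => by
        rw [← ABStructure.a_b_sub_b_a y]; abel
      have e : a (φ ((PowerSeries.X * t + PowerSeries.C c) • x)) -
          φ (a ((PowerSeries.X * t + PowerSeries.C c) • x)) -
          (PowerSeries.X * t + PowerSeries.C c) • (a (φ x) - φ (a x)) =
          (PowerSeries.X : ℂ⟦X⟧) • (a (φ (t • x)) - φ (a (t • x)) -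
            t • (a (φ x) - φ (a x))) := by
        simp only [add_smul, mul_smul, map_add, h1, h2, ABStructure.a_const_smul, map_smul,
          smul_sub]
        abel
      rw [e, map_smul, smul_eq_mul, pow_succ']
      exact mul_dvd_mul_left _ (ih t)
  rw [← sub_eq_zero]
  apply (Elem.series 0).injective
  rw [map_zero]
  ext n
  exact (PowerSeries.X_pow_dvd_iff.1 (key (n + 1) s)) n (Nat.lt_succ_self n)

/-- The dual `E^* = Hom(E, E_0)`. -/
abbrev Dual (E : Type*) [AddCommGroup E] [Module ℂ⟦X⟧ E] : Type _ := E →ₗ[ℂ⟦X⟧] Elem 0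

/-- The `(a,b)`-structure of the dual: `(a φ)(x) = a φ(x) - φ(a x)`. -/
noncomputable instance : ABStructure (Dual E) where
  a := AddMonoidHom.mk' (fun φ =>
    { toFun := fun x => a (φ x) - φ (a x)
      map_add' := fun x y => by
        simp only [map_add]
        abel
      map_smul' := fun s x => dual_aux φ s x }) (fun φ ψ => by
    ext x
    simp only [LinearMap.coe_mk, AddHom.coe_mk, LinearMap.add_apply, map_add]
    abel)
  a_const_smul c φ := by
    ext x
    simp only [AddMonoidHom.mk'_apply, LinearMap.coe_mk, AddHom.coe_mk, LinearMap.smul_apply,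
      ABStructure.a_const_smul, smul_sub]
  a_b_sub_b_a φ := by
    ext x
    have h := ABStructure.a_b_sub_b_a (φ x)
    simp only [AddMonoidHom.mk'_apply, LinearMap.coe_mk, AddHom.coe_mk, LinearMap.smul_apply,
      LinearMap.sub_apply, smul_sub]
    rw [← h]
    abel

theorem dual_a_apply (φ : Dual E) (x : E) : (a φ : Dual E) x = a (φ x) - φ (a x) := rfl

end Dual

/-- The conjugate of `E`: the same set with the signs of `a` and `b` reversed, that is, `S(b)` acts
as `S(-b)`. -/
def Conj (E : Type*) : Type _ := E

section Conj

variable {E : Type*} [AddCommGroup E] [Module ℂ⟦X⟧ E]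

instance : AddCommGroup (Conj E) := inferInstanceAs (AddCommGroup E)

noncomputable instance : Module ℂ⟦X⟧ (Conj E) :=
  Module.compHom E (PowerSeries.evalNegHom : ℂ⟦X⟧ →+* ℂ⟦X⟧)

/-- The identity map from `E` to its conjugate. -/
def toConj (E : Type*) [AddCommGroup E] : E ≃+ Conj E := AddEquiv.refl E

theorem smul_toConj (s : ℂ⟦X⟧) (x : E) :
    s • toConj E x = toConj E ((PowerSeries.evalNegHom s : ℂ⟦X⟧) • x) := rfl

theorem evalNegHom_C (c : ℂ) :
    (PowerSeries.evalNegHom (PowerSeries.C c : ℂ⟦X⟧) : ℂ⟦X⟧) = PowerSeries.C c := by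
  ext n
  rw [PowerSeries.evalNegHom, PowerSeries.coeff_rescale, PowerSeries.coeff_C]
  split_ifs with h
  · simp [h]
  · simp

noncomputable instance [ABStructure E] : ABStructure (Conj E) where
  a := AddMonoidHom.mk' (fun x => toConj E (-a ((toConj E).symm x))) (fun x y => by
    rw [map_add, map_add, neg_add, map_add])
  a_const_smul c x := by
    obtain ⟨y, rfl⟩ := (toConj E).surjective x
    simp only [AddMonoidHom.mk'_apply, smul_toConj, AddEquiv.symm_apply_apply, evalNegHom_C,
      ABStructure.a_const_smul, smul_neg]
  a_b_sub_b_a x := by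
    obtain ⟨y, rfl⟩ := (toConj E).surjective x
    simp only [AddMonoidHom.mk'_apply, smul_toConj, AddEquiv.symm_apply_apply, map_pow,
      PowerSeries.evalNegHom_X, neg_smul, map_neg, neg_neg, even_two, Even.neg_pow, smul_neg]
    rw [← map_sub, ABStructure.a_b_sub_b_a]

theorem a_toConj [ABStructure E] (x : E) : a (toConj E x) = toConj E (-a x) := rfl

end Conj

/-- The adjoint of `E`: the conjugate of the dual. -/
abbrev Adjoint (E : Type*) [AddCommGroup E] [Module ℂ⟦X⟧ E] : Type _ := Conj (Dual E)

/-- `E` is self-adjoint if it is isomorphic to its adjoint. -/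
def IsSelfAdjoint (E : Type*) [AddCommGroup E] [Module ℂ⟦X⟧ E] [ABStructure E] : Prop :=
  IsIso E (Adjoint E)

/-! ### Bilinear and hermitian forms -/

section Forms

variable {E F G : Type*} [AddCommGroup E] [Module ℂ⟦X⟧ E] [ABStructure E]
  [AddCommGroup F] [Module ℂ⟦X⟧ F] [ABStructure F]
  [AddCommGroup G] [Module ℂ⟦X⟧ G] [ABStructure G]

/-- A `ℂ⟦b⟧`-bilinear map `Φ` is `(a,b)`-bilinear if `a Φ(v,w) = Φ(a v,w) + Φ(v,a w)`. -/
def IsABBilinear (Φ : E →ₗ[ℂ⟦X⟧] F →ₗ[ℂ⟦X⟧] G) : Prop :=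
  ∀ (v : E) (w : F), a (Φ v w) = Φ (a v) w + Φ v (a w)

/-- An `(a,b)`-bilinear form on `E × F` is non-degenerate if `v ↦ Φ(v,·)` is an isomorphism from
`E` onto the dual of `F`; this map automatically commutes with `a` by
`IsABBilinear.map_a`. -/
def IsNondegenerate (Φ : E →ₗ[ℂ⟦X⟧] F →ₗ[ℂ⟦X⟧] Elem 0) : Prop :=
  Function.Bijective (Φ : E → Dual F)

theorem IsABBilinear.map_a {Φ : E →ₗ[ℂ⟦X⟧] F →ₗ[ℂ⟦X⟧] Elem 0} (h : IsABBilinear Φ) (v : E) :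
    (Φ (a v) : Dual F) = a (Φ v : Dual F) := by
  ext w
  rw [dual_a_apply, h v w, add_sub_cancel_right]

/-- `(a,b)`-hermitian forms: `(a,b)`-bilinear forms between `E` and its conjugate such that
`Φ(v,w) = S(b) e_0` implies `Φ(w,v) = S(-b) e_0`. -/
def IsHermitianForm (Φ : E →ₗ[ℂ⟦X⟧] Conj E →ₗ[ℂ⟦X⟧] Elem 0) : Prop :=
  IsABBilinear Φ ∧ ∀ v w : E, Elem.series 0 (Φ w (toConj E v)) =
    PowerSeries.evalNegHom (Elem.series 0 (Φ v (toConj E w)))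

/-- `(a,b)`-anti-hermitian forms: `Φ(v,w) = S(b) e_0` implies `Φ(w,v) = -S(-b) e_0`. -/
def IsAntiHermitianForm (Φ : E →ₗ[ℂ⟦X⟧] Conj E →ₗ[ℂ⟦X⟧] Elem 0) : Prop :=
  IsABBilinear Φ ∧ ∀ v w : E, Elem.series 0 (Φ w (toConj E v)) =
    -PowerSeries.evalNegHom (Elem.series 0 (Φ v (toConj E w)))

variable (E)

/-- `E` is hermitian if it admits a non-degenerate hermitian form. -/
def IsHermitian : Prop :=
  ∃ Φ : E →ₗ[ℂ⟦X⟧] Conj E →ₗ[ℂ⟦X⟧] Elem 0, IsHermitianForm Φ ∧ IsNondegenerate Φ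

/-- `E` is anti-hermitian if it admits a non-degenerate anti-hermitian form. -/
def IsAntiHermitian : Prop :=
  ∃ Φ : E →ₗ[ℂ⟦X⟧] Conj E →ₗ[ℂ⟦X⟧] Elem 0, IsAntiHermitianForm Φ ∧ IsNondegenerate Φ

end Forms

/-! ### Regular modules and Jordan-Hölder series -/

universe u

/-- `E` is regular if it embeds, as a sub-`(a,b)`-module, into an `(a,b)`-module `M` (free of finite
rank) with `a M ⊆ b M`. -/
def IsRegular (E : Type u) [AddCommGroup E] [Module ℂ⟦X⟧ E] [ABStructure E] : Prop :=
  ∃ (M : Type u) (_ : AddCommGroup M) (_ : Module ℂ⟦X⟧ M) (_ : ABStructure M),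
    Module.Free ℂ⟦X⟧ M ∧ Module.Finite ℂ⟦X⟧ M ∧
    (∀ y : M, ∃ z : M, a y = (PowerSeries.X : ℂ⟦X⟧) • z) ∧
    ∃ f : E →ₗ[ℂ⟦X⟧] M, Function.Injective f ∧ ∀ x : E, f (a x) = a (f x)

/-- A Jordan-Hölder composition series `0 = F_0 ⊊ F_1 ⊊ ... ⊊ F_n = E` with all `F_j` normal in `E`
and with elementary quotients `F_j / F_{j-1} ≃ E_{λ_j}`; the parameter `λ_j` is
`param (j - 1)`, with indices starting from `0`. -/
structure JHSeries (E : Type*) [AddCommGroup E] [Module ℂ⟦X⟧ E] [ABStructure E] (n : ℕ) where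
  F : Fin (n + 1) → ABSubmodule E
  param : Fin n → ℂ
  bot : (F 0).toSubmodule = ⊥
  top : (F (Fin.last n)).toSubmodule = ⊤
  lt : ∀ j : Fin n, (F j.castSucc).toSubmodule < (F j.succ).toSubmodule
  normal : ∀ j, (F j).IsNormal
  quotient : ∀ j : Fin n, IsIso (Subquotient (F j.succ) (F j.castSucc)) (Elem (param j))

/-- The series is self-adjoint if `λ_{n-j+1} = -λ_j` for `1 ≤ j ≤ n` and `F_{n-j} / F_j` is
self-adjoint for `0 ≤ j ≤ [n/2]`; here `Fin.rev` reverses the index range. -/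
def JHSeries.IsSelfAdjoint {E : Type*} [AddCommGroup E] [Module ℂ⟦X⟧ E] [ABStructure E] {n : ℕ}
    (s : JHSeries E n) : Prop :=
  (∀ j : Fin n, s.param j.rev = -s.param j) ∧
  ∀ j : Fin (n + 1), (j : ℕ) ≤ n / 2 → AB.IsSelfAdjoint (Subquotient (s.F j.rev) (s.F j))

end AB

/-!
Both cases are treated at once, for non-degenerate forms `Φ` of a sign `ε = ±1`, by induction on the
rank in steps of two: an isotropic normal line `L`, isomorphic to some `E_l`, is split off. The form
induces a non-degenerate form of the same sign on `L^⊥ / L`, and identifies `E / L^⊥` with the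
adjoint of `L`, which is `E_{-l}`. A self-adjoint series of `L^⊥ / L` is pulled back to `E` and
completed by `0` and `E`; its inner subquotients are unchanged, and `E` itself is self-adjoint
through `Φ`. In rank one, `Φ(e,e)` is a unit for a generator `e` with `a e = l b e`, and bilinearity
gives `b S' = 2 l S` for `S = Φ(e,e)`, whence `l = 0`.

The isotropic line comes from `IsSignedForm.exists_isotropic_eigenvector`. Regularity provides a
submodule `R` of full rank with `a R ⊆ b R`, a property that passes to normal submodules and to
quotients, unlike an embedding into a larger module, which would have to be rebuilt each time. On
such an `R` the operator `b⁻¹ a` has an eigenvector (`exists_eigenvector_of_endomorphism`), so there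
is `x ≠ 0` with `a x = l b x`. If `Φ(x,x) ≠ 0`, the equation above forces `Φ(x,x) = c b ^ k` with
`k = 2 l`, and `ε = (-1) ^ k` by the symmetry of `Φ`. In rank at least two there is a second
eigenvector `y` orthogonal to `x`; if it is not isotropic either, its exponent has the same parity
as `k`. Hence multiplying `x` or `y` by a power of `b` makes the parameters equal, and a combination
with coefficients in `ℂ` is an isotropic eigenvector. Dividing it by a power of `b` yields a
generator of a normal line.
-/

namespace AB

open ABStructure (a)
open PowerSeries (X C evalNegHom)

/-! ### The operators `a` and `b` on free modules -/

section Basic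

/-- The `ℕ`-algebra structure found by default on `ℂ⟦b⟧` comes from that of `ℂ`; this shortcut to
the generic one lets the tactic `module` find the scalar tower `ℕ`, `ℂ⟦b⟧`, `E`. -/
noncomputable instance natAlgebra : Algebra ℕ ℂ⟦X⟧ := Semiring.toNatAlgebra

/-- The analogue of `natAlgebra` for `ℤ`. -/
noncomputable instance intAlgebra : Algebra ℤ ℂ⟦X⟧ := Ring.toIntAlgebra _

variable {E : Type*} [AddCommGroup E] [Module ℂ⟦X⟧ E]

/-- A free `ℂ⟦b⟧`-module is `b`-adically separated. -/
theorem eq_zero_of_forall_X_pow [Module.Free ℂ⟦X⟧ E] {x : E}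
    (h : ∀ N : ℕ, ∃ y : E, x = (X ^ N : ℂ⟦X⟧) • y) : x = 0 := by
  have B := Module.Free.chooseBasis ℂ⟦X⟧ E
  refine B.ext_elem fun i => ?_
  ext n
  obtain ⟨y, rfl⟩ := h (n + 1)
  simpa using PowerSeries.X_pow_dvd_iff.1 (dvd_mul_right (X ^ (n + 1)) (B.repr y i)) n
    n.lt_succ_self

theorem X_smul_injective [Module.IsTorsionFree ℂ⟦X⟧ E] {x y : E}
    (h : (X : ℂ⟦X⟧) • x = (X : ℂ⟦X⟧) • y) : x = y :=
  smul_right_injective E PowerSeries.X_ne_zero h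

theorem X_pow_smul_injective [Module.IsTorsionFree ℂ⟦X⟧ E] (N : ℕ) {x y : E}
    (h : (X ^ N : ℂ⟦X⟧) • x = (X ^ N : ℂ⟦X⟧) • y) : x = y :=
  smul_right_injective E (pow_ne_zero N PowerSeries.X_ne_zero) h

theorem exists_eq_X_mul_add_C (s : ℂ⟦X⟧) : ∃ (t : ℂ⟦X⟧) (c : ℂ), s = X * t + C c :=
  ⟨_, _, PowerSeries.eq_X_mul_shift_add_const s⟩

theorem isUnit_X_mul_add_C (t : ℂ⟦X⟧) {c : ℂ} (hc : c ≠ 0) : IsUnit (X * t + C c) := by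
  rw [PowerSeries.isUnit_iff_constantCoeff]
  simpa using hc

/-- Every nonzero series is a power of `b` times a unit, so over `ℂ⟦b⟧` torsion is `b`-torsion. -/
theorem isTorsionFree_of_X (h : ∀ x : E, (X : ℂ⟦X⟧) • x = 0 → x = 0) :
    Module.IsTorsionFree ℂ⟦X⟧ E := by
  have hN : ∀ (N : ℕ) (x : E), (X ^ N : ℂ⟦X⟧) • x = 0 → x = 0 := by
    intro N
    induction N with
    | zero => intro x hx; simpa using hx
    | succ N ih =>
      intro x hx
      rw [pow_succ, mul_smul] at hx
      exact h x (ih _ hx)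
  refine .of_smul_eq_zero fun s x hx => ?_
  by_cases hs : s = 0
  · exact Or.inl hs
  · obtain ⟨k, u, rfl⟩ := IsDiscreteValuationRing.eq_unit_mul_pow_irreducible hs
      PowerSeries.X_irreducible
    right
    rw [mul_smul, ← Units.smul_def, smul_eq_zero_iff_eq] at hx
    exact hN k x hx

/-- Every nonzero element of a free module is a power of `b` times an element not divisible
by `b`. -/
theorem exists_eq_X_pow_smul [Module.Free ℂ⟦X⟧ E] {x : E} (hx : x ≠ 0) :
    ∃ (k : ℕ) (y : E), x = (X ^ k : ℂ⟦X⟧) • y ∧ ∀ z : E, y ≠ (X : ℂ⟦X⟧) • z := by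
  classical
  have h : ∃ N : ℕ, ¬ ∃ y : E, x = (X ^ N : ℂ⟦X⟧) • y := by
    by_contra! h
    exact hx (eq_zero_of_forall_X_pow h)
  have h0 : Nat.find h ≠ 0 := fun h0 => Nat.find_spec h ⟨x, by rw [h0, pow_zero, one_smul]⟩
  obtain ⟨k, hk⟩ := Nat.exists_eq_succ_of_ne_zero h0
  obtain ⟨y, hy⟩ := not_not.1 (Nat.find_min h (hk ▸ k.lt_succ_self : k < Nat.find h))
  refine ⟨k, y, hy, fun z hz => Nat.find_spec h ⟨z, ?_⟩⟩
  rw [hk, hy, hz, pow_succ, mul_smul]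

/-- A free module of finite rank is `b`-adically complete: the series `∑ b ^ k y_k` converge. -/
theorem exists_sum_X_pow_smul [Module.Free ℂ⟦X⟧ E] [Module.Finite ℂ⟦X⟧ E] (y : ℕ → E) :
    ∃ x : E, ∀ N : ℕ, ∃ z : E,
      x = ∑ k ∈ Finset.range N, (X ^ k : ℂ⟦X⟧) • y k + (X ^ N : ℂ⟦X⟧) • z := by
  have B := Module.Free.chooseBasis ℂ⟦X⟧ E
  let r : (Module.Free.ChooseBasisIndex ℂ⟦X⟧ E) → ℂ⟦X⟧ := fun i =>
    PowerSeries.mk fun m => ∑ k ∈ Finset.range (m + 1), PowerSeries.coeff (m - k) (B.repr (y k) i)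
  refine ⟨B.equivFun.symm r, fun N => ?_⟩
  have h : ∀ i, ∃ s : ℂ⟦X⟧, r i - ∑ k ∈ Finset.range N, X ^ k * B.repr (y k) i = X ^ N * s := by
    intro i
    refine PowerSeries.X_pow_dvd_iff.2 fun m hm => ?_
    rw [map_sub, sub_eq_zero, map_sum, PowerSeries.coeff_mk]
    have hsub : Finset.range (m + 1) ⊆ Finset.range N := Finset.range_subset_range.2 hm
    rw [← Finset.sum_subset hsub]
    · refine Finset.sum_congr rfl fun k hk => ?_
      rw [PowerSeries.coeff_X_pow_mul', if_pos (Nat.lt_succ_iff.1 (Finset.mem_range.1 hk))]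
    · intro k _ hk
      rw [PowerSeries.coeff_X_pow_mul', if_neg]
      simpa using hk
  choose s hs using h
  refine ⟨B.equivFun.symm s, B.ext_elem fun i => ?_⟩
  have hr := hs i
  rw [sub_eq_iff_eq_add] at hr
  have e1 : B.repr (B.equivFun.symm r) i = r i := by
    rw [← B.equivFun_apply, LinearEquiv.apply_symm_apply]
  have e2 : B.repr (B.equivFun.symm s) i = s i := by
    rw [← B.equivFun_apply, LinearEquiv.apply_symm_apply]
  rw [e1, hr, map_add, map_sum, Finsupp.add_apply, Finsupp.finsetSum_apply]
  simp only [map_smul, Finsupp.smul_apply, smul_eq_mul, e2]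
  rw [add_comm]

variable [ABStructure E]

theorem a_X_smul (x : E) :
    a ((X : ℂ⟦X⟧) • x) = (X : ℂ⟦X⟧) • a x + (X ^ 2 : ℂ⟦X⟧) • x := by
  rw [← ABStructure.a_b_sub_b_a x]
  abel

/-- The operator `a` acts on multiples of `x` by the Leibniz rule for `b ^ 2 d/db`. -/
theorem a_smul [Module.Free ℂ⟦X⟧ E] (s : ℂ⟦X⟧) (x : E) :
    a (s • x) = s • a x + (X ^ 2 * PowerSeries.derivative ℂ s) • x := by
  rw [← sub_eq_zero]
  refine eq_zero_of_forall_X_pow fun N => ?_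
  induction N generalizing s with
  | zero => exact ⟨_, (one_smul _ _).symm⟩
  | succ N ih =>
    obtain ⟨t, c, rfl⟩ := exists_eq_X_mul_add_C s
    obtain ⟨y, hy⟩ := ih t
    refine ⟨y, ?_⟩
    have hd : PowerSeries.derivative ℂ (X * t + C c) = X * PowerSeries.derivative ℂ t + t := by
      rw [map_add, Derivation.leibniz, PowerSeries.derivative_X, PowerSeries.derivative_C]
      simp
    rw [pow_succ' X N, mul_smul X (X ^ N) y, ← hy, hd]
    simp only [add_smul, mul_smul, map_add, a_X_smul, ABStructure.a_const_smul]
    module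

end Basic

/-! ### Eigenvectors of simple-pole lattices -/

section Eigen

/-- A `ℂ`-linear operator `θ` on a free module of finite rank with `θ b - b θ = b` has an
eigenvector. An eigenvalue `l` of `θ` modulo `b` whose real part is minimal lifts: the successive
corrections are solved by inverting `θ + k - l` modulo `b` for `k ≥ 1`, which is possible as
`l - k` is not an eigenvalue, and the resulting series converges `b`-adically. -/
theorem exists_eigenvector_of_endomorphism {M : Type*} [AddCommGroup M] [Module ℂ⟦X⟧ M]
    [Module.Free ℂ⟦X⟧ M] [Module.Finite ℂ⟦X⟧ M] [Nontrivial M] (θ : M →+ M)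
    (hC : ∀ (c : ℂ) (x : M), θ ((C c : ℂ⟦X⟧) • x) = (C c : ℂ⟦X⟧) • θ x)
    (hX : ∀ x : M, θ ((X : ℂ⟦X⟧) • x) = (X : ℂ⟦X⟧) • (θ x + x)) :
    ∃ (l : ℂ) (x : M), x ≠ 0 ∧ θ x = (C l : ℂ⟦X⟧) • x := by
  classical
  let ι := Module.Free.ChooseBasisIndex ℂ⟦X⟧ M
  let B : Module.Basis ι ℂ⟦X⟧ M := Module.Free.chooseBasis ℂ⟦X⟧ M
  have : Nonempty ι := B.index_nonempty
  -- reduction modulo `b` and its section by constant vectors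
  let π : M →+ (ι → ℂ) := AddMonoidHom.mk' (fun x i => PowerSeries.constantCoeff (B.repr x i))
    (fun x y => by ext i; simp)
  let σ : (ι → ℂ) →+ M := AddMonoidHom.mk' (fun v => B.equivFun.symm fun i => C (v i))
    (fun v w => by rw [← map_add]; congr 1; ext i; simp)
  have πC : ∀ (c : ℂ) (x : M), π ((C c : ℂ⟦X⟧) • x) = c • π x := by
    intro c x; ext i; simp [π]
  have πX : ∀ x : M, π ((X : ℂ⟦X⟧) • x) = 0 := by
    intro x; ext i; simp [π]
  have πσ : ∀ v, π (σ v) = v := by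
    intro v; ext i
    change PowerSeries.constantCoeff (B.repr (B.equivFun.symm fun i => C (v i)) i) = v i
    rw [← B.equivFun_apply, LinearEquiv.apply_symm_apply, PowerSeries.constantCoeff_C]
  have σC : ∀ (c : ℂ) v, σ (c • v) = (C c : ℂ⟦X⟧) • σ v := by
    intro c v
    change (B.equivFun.symm fun i => C ((c • v) i)) = C c • B.equivFun.symm fun i => C (v i)
    rw [← map_smul]; congr 1; ext i; simp
  have ker : ∀ x : M, π x = 0 → ∃ y, x = (X : ℂ⟦X⟧) • y := by
    intro x hx
    have h : ∀ i, ∃ t, B.repr x i = X * t := fun i =>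
      PowerSeries.X_dvd_iff.2 (congrFun hx i)
    choose t ht using h
    refine ⟨B.equivFun.symm t, B.equivFun.injective ?_⟩
    ext1 i
    rw [map_smul, LinearEquiv.apply_symm_apply, B.equivFun_apply, ht]
    rfl
  let T : Module.End ℂ (ι → ℂ) :=
    { toFun := fun v => π (θ (σ v))
      map_add' := fun v w => by simp only [map_add]
      map_smul' := fun c v => by simp only [σC, hC, πC, RingHom.id_apply] }
  have πθ : ∀ x, π (θ x) = T (π x) := by
    intro x
    obtain ⟨y, hy⟩ := ker (x - σ (π x)) (by rw [map_sub, πσ, sub_self])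
    have : π (θ (x - σ (π x))) = 0 := by rw [hy, hX, πX]
    rw [map_sub, map_sub, sub_eq_zero] at this
    exact this
  obtain ⟨l₀, hl₀⟩ := Module.End.exists_eigenvalue T
  obtain ⟨l, hl, hmin⟩ := (Module.End.finite_hasEigenvalue T).exists_minimalFor Complex.re _
    ⟨l₀, hl₀⟩
  have hsurj : ∀ k : ℕ, Function.Surjective
      (T - algebraMap ℂ (Module.End ℂ (ι → ℂ)) (l - (k + 1))) := by
    intro k
    rw [← LinearMap.injective_iff_surjective, ← LinearMap.ker_eq_bot]
    by_contra h
    have h1 : T.HasEigenvalue (l - (k + 1)) := by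
      rw [Module.End.hasEigenvalue_iff, Module.End.eigenspace_def]
      exact h
    have h2 := hmin h1 (by simp; positivity)
    simp at h2
    have : (0 : ℝ) ≤ k := k.cast_nonneg
    linarith
  -- `step` divides the error by `b` once more
  have step : ∀ (k : ℕ) (z : M), ∃ p : M × M,
      θ p.1 + (C ((k : ℂ) + 1 - l) : ℂ⟦X⟧) • p.1 + z = (X : ℂ⟦X⟧) • p.2 := by
    intro k z
    obtain ⟨v, hv⟩ := hsurj k (-π z)
    obtain ⟨y, hy⟩ := ker (θ (σ v) + (C ((k : ℂ) + 1 - l) : ℂ⟦X⟧) • σ v + z) (by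
      rw [map_add, map_add, πθ, πC, πσ]
      rw [LinearMap.sub_apply, Module.algebraMap_end_apply, sub_eq_iff_eq_add] at hv
      rw [hv]
      module)
    exact ⟨(σ v, y), hy⟩
  choose p hp using step
  obtain ⟨v₀, hv₀⟩ := hl.exists_hasEigenvector
  obtain ⟨z₀, hz₀⟩ := ker (θ (σ v₀) - (C l : ℂ⟦X⟧) • σ v₀) (by
    rw [map_sub, πθ, πC, πσ, hv₀.apply_eq_smul, sub_self])
  -- the pairs (term of the series, remaining error divided by the power of `b`)
  let q : ℕ → M × M := fun n => Nat.rec (σ v₀, z₀) (fun k r => p k r.2) n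
  have hθ : ∀ (k : ℕ) (x : M), θ ((X ^ k : ℂ⟦X⟧) • x) =
      (X ^ k : ℂ⟦X⟧) • (θ x + (C (k : ℂ) : ℂ⟦X⟧) • x) := by
    intro k
    induction k with
    | zero => intro x; simp
    | succ k ih =>
      intro x
      rw [pow_succ, mul_smul, ih, hX]
      simp only [Nat.cast_succ, map_add, map_one]
      module
  have herr : ∀ N : ℕ, θ (∑ k ∈ Finset.range (N + 1), (X ^ k : ℂ⟦X⟧) • (q k).1) -
      (C l : ℂ⟦X⟧) • ∑ k ∈ Finset.range (N + 1), (X ^ k : ℂ⟦X⟧) • (q k).1 =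
      (X ^ (N + 1) : ℂ⟦X⟧) • (q N).2 := by
    intro N
    induction N with
    | zero => simpa [q] using hz₀
    | succ N ih =>
      rw [Finset.sum_range_succ, map_add, smul_add, hθ, add_sub_add_comm, ih]
      have h := hp N (q N).2
      rw [pow_succ X (N + 1), mul_smul]
      change _ = (X ^ (N + 1) : ℂ⟦X⟧) • (X : ℂ⟦X⟧) • (p N (q N).2).2
      rw [← h]
      change _ + ((X ^ (N + 1) : ℂ⟦X⟧) • (θ (p N (q N).2).1 + _ • (p N (q N).2).1) -
        C l • (X ^ (N + 1) : ℂ⟦X⟧) • (p N (q N).2).1) = _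
      simp only [map_sub, map_add, map_one, Nat.cast_succ]
      module
  obtain ⟨x, hx⟩ := exists_sum_X_pow_smul fun k => (q k).1
  refine ⟨l, x, ?_, ?_⟩
  · rintro rfl
    obtain ⟨z, hz⟩ := hx 1
    have h := congrArg π hz
    rw [Finset.sum_range_one, map_add, pow_one, πX, pow_zero, one_smul, map_zero, add_zero] at h
    change 0 = π (σ v₀) at h
    rw [πσ] at h
    exact hv₀.2 h.symm
  · rw [← sub_eq_zero]
    refine eq_zero_of_forall_X_pow fun N => ?_
    obtain ⟨z, hz⟩ := hx (N + 1)
    have e := herr N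
    refine ⟨(X : ℂ⟦X⟧) • (q N).2 + (X : ℂ⟦X⟧) • (θ z + (C ((N + 1 : ℕ) : ℂ) : ℂ⟦X⟧) • z -
      (C l : ℂ⟦X⟧) • z), ?_⟩
    rw [hz, map_add, hθ, smul_add (C l), add_sub_add_comm, e]
    module

variable {E : Type*} [AddCommGroup E] [Module ℂ⟦X⟧ E] [ABStructure E]

/-- A simple-pole submodule: a `ℂ⟦b⟧`-submodule `R` with `a R ⊆ b R`. -/
def IsSimplePole (R : Submodule ℂ⟦X⟧ E) : Prop :=
  ∀ x ∈ R, ∃ z ∈ R, a x = (X : ℂ⟦X⟧) • z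

theorem IsSimplePole.exists_eigenvector [Module.Free ℂ⟦X⟧ E] [Module.Finite ℂ⟦X⟧ E]
    {R : Submodule ℂ⟦X⟧ E} (hR : IsSimplePole R) (h0 : R ≠ ⊥) :
    ∃ (l : ℂ) (x : E), x ∈ R ∧ x ≠ 0 ∧ a x = (C l * X : ℂ⟦X⟧) • x := by
  have : Nontrivial R := Submodule.nontrivial_iff_ne_bot.2 h0
  choose z hzR hz using hR
  let f : R → R := fun x => ⟨z x x.2, hzR x x.2⟩
  have hf : ∀ x : R, (X : ℂ⟦X⟧) • (f x : E) = a (x : E) := fun x => (hz x x.2).symm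
  let θ : R →+ R := AddMonoidHom.mk' f (fun x y => by
    ext
    refine X_smul_injective (E := E) ?_
    rw [hf, Submodule.coe_add, Submodule.coe_add, smul_add, hf, hf, map_add])
  obtain ⟨l, x, hx, h⟩ := exists_eigenvector_of_endomorphism θ
    (fun c x => by
      ext
      refine X_smul_injective (E := E) ?_
      change X • (f _ : E) = X • C c • (f _ : E)
      rw [smul_comm, hf, hf, Submodule.coe_smul, ABStructure.a_const_smul])
    (fun x => by
      ext
      refine X_smul_injective (E := E) ?_
      change X • (f _ : E) = X • X • ((f x : E) + x)
      rw [hf, smul_add, hf, Submodule.coe_smul, a_X_smul, smul_add, pow_two, mul_smul])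
  refine ⟨l, x, x.2, by simpa using hx, ?_⟩
  have h2 : (f x : E) = (C l : ℂ⟦X⟧) • (x : E) := congrArg Subtype.val h
  rw [← hf, h2, mul_comm, mul_smul]

/-- A regular module contains a simple-pole submodule of full rank. Inside a simple-pole module
`M ⊇ E` it is `b ^ N M'`, where `M'` consists of the elements of `M` with a `b`-power multiple in
`E`, and `b ^ N M' ⊆ E`. -/
theorem IsRegular.exists_lattice (h : IsRegular E) :
    ∃ R : Submodule ℂ⟦X⟧ E, IsSimplePole R ∧ ∃ N : ℕ, ∀ x : E, (X ^ N : ℂ⟦X⟧) • x ∈ R := by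
  obtain ⟨M, _, _, _, _, _, hM, f, hf, hfa⟩ := h
  let K : ℕ →o Submodule ℂ⟦X⟧ M :=
    { toFun := fun k => (LinearMap.range f).comap (LinearMap.lsmul ℂ⟦X⟧ M (X ^ k))
      monotone' := by
        refine monotone_nat_of_le_succ fun k y hy => ?_
        rw [Submodule.mem_comap, LinearMap.lsmul_apply] at hy ⊢
        rw [pow_succ', mul_smul]
        exact Submodule.smul_mem _ _ hy }
  obtain ⟨N, hN⟩ := monotone_stabilizes_iff_noetherian.2
    (inferInstance : IsNoetherian ℂ⟦X⟧ M) K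
  have hK : ∀ k y, y ∈ K k ↔ (X ^ k : ℂ⟦X⟧) • y ∈ LinearMap.range f := fun k y => Iff.rfl
  let R : Submodule ℂ⟦X⟧ E := ((K N).map (LinearMap.lsmul ℂ⟦X⟧ M (X ^ N))).comap f
  have hR : ∀ x, x ∈ R ↔ ∃ y ∈ K N, (X ^ N : ℂ⟦X⟧) • y = f x := fun x => Iff.rfl
  refine ⟨R, fun x hx => ?_, N, fun x => ?_⟩
  · obtain ⟨y, hy, hyx⟩ := (hR x).1 hx
    obtain ⟨w, hw⟩ := hM y
    have e : f (a x) = (X ^ (N + 1) : ℂ⟦X⟧) • (w + (C (N : ℂ) : ℂ⟦X⟧) • y) := by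
      rw [hfa, ← hyx, a_smul, hw, PowerSeries.derivative_pow, PowerSeries.derivative_X]
      rcases N with _ | N
      · simp
      · simp only [Nat.add_sub_cancel, map_natCast]
        module
    have hmem : w + (C (N : ℂ) : ℂ⟦X⟧) • y ∈ K N := by
      rw [hN (N + 1) N.le_succ, hK, ← e]
      exact ⟨_, rfl⟩
    obtain ⟨x', hx'⟩ := (hK _ _).1 hmem
    refine ⟨x', (hR x').2 ⟨_, hmem, hx'.symm⟩, hf ?_⟩
    rw [e, map_smul, hx', pow_succ', mul_smul]
  · refine (hR _).2 ⟨f x, ?_, by rw [map_smul]⟩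
    rw [hK, ← map_smul]
    exact ⟨_, rfl⟩

end Eigen

/-! ### Isomorphisms, subquotients and self-adjointness -/

section Iso

variable {E F G : Type*} [AddCommGroup E] [Module ℂ⟦X⟧ E] [ABStructure E]
  [AddCommGroup F] [Module ℂ⟦X⟧ F] [ABStructure F]
  [AddCommGroup G] [Module ℂ⟦X⟧ G] [ABStructure G]

theorem IsIso.symm (h : IsIso E F) : IsIso F E := by
  obtain ⟨f, hf⟩ := h
  exact ⟨f.symm, fun y => f.injective (by rw [hf, f.apply_symm_apply, f.apply_symm_apply])⟩

theorem IsIso.trans (h : IsIso E F) (h' : IsIso F G) : IsIso E G := by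
  obtain ⟨f, hf⟩ := h
  obtain ⟨g, hg⟩ := h'
  exact ⟨f.trans g, fun x => by simp only [LinearEquiv.trans_apply, hf, hg]⟩

theorem IsIso.adjoint (h : IsIso E F) : IsIso (Adjoint F) (Adjoint E) := by
  obtain ⟨f, hf⟩ := h
  refine ⟨
    { toFun := fun φ => toConj _ (((toConj _).symm φ : Dual F) ∘ₗ (f : E →ₗ[ℂ⟦X⟧] F))
      invFun := fun φ => toConj _ (((toConj _).symm φ : Dual E) ∘ₗ (f.symm : F →ₗ[ℂ⟦X⟧] E))
      map_add' := fun φ ψ => rfl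
      map_smul' := fun s φ => rfl
      left_inv := fun φ => ?_
      right_inv := fun φ => ?_ }, fun φ => ?_⟩
  · refine LinearMap.ext fun x => ?_
    exact congrArg ((toConj _).symm φ : Dual F) (f.apply_symm_apply x)
  · refine LinearMap.ext fun x => ?_
    exact congrArg ((toConj _).symm φ : Dual E) (f.symm_apply_apply x)
  · refine LinearMap.ext fun x => ?_
    obtain ⟨φ, rfl⟩ := (toConj _).surjective φ
    change -(a (φ (f x)) - φ (a (f x))) = -(a (φ (f x)) - φ (f (a x)))
    rw [hf]

theorem IsSelfAdjoint.of_isIso (h : IsIso E F) (hF : IsSelfAdjoint F) : IsSelfAdjoint E :=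
  (h.trans hF).trans h.adjoint

/-- The first isomorphism theorem for subquotients. -/
theorem isIso_subquotient {P L : ABSubmodule E} (g : P.toSubmodule →ₗ[ℂ⟦X⟧] F)
    (hg : Function.Surjective g) (ha : ∀ x, g (a x) = a (g x))
    (hk : ∀ x : P.toSubmodule, g x = 0 ↔ (x : E) ∈ L.toSubmodule) :
    IsIso (Subquotient P L) F := by
  have h : (L.within P).toSubmodule = LinearMap.ker g := by
    ext x
    exact (hk x).symm
  refine ⟨(Submodule.quotEquivOfEq _ _ h).trans (g.quotKerEquivOfSurjective hg), fun x => ?_⟩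
  obtain ⟨y, rfl⟩ := (L.within P).toSubmodule.mkQ_surjective x
  exact ha y

theorem isNormal_iff [Module.Finite ℂ⟦X⟧ E] (P : ABSubmodule E) :
    P.IsNormal ↔ ∀ x : E, (X : ℂ⟦X⟧) • x ∈ P.toSubmodule → x ∈ P.toSubmodule := by
  constructor
  · intro h x hx
    have : Module.Free ℂ⟦X⟧ (E ⧸ P.toSubmodule) := h
    rw [← Submodule.Quotient.mk_eq_zero] at hx ⊢
    rw [Submodule.Quotient.mk_smul] at hx
    exact X_smul_injective (hx.trans (smul_zero _).symm)
  · intro h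
    have : Module.IsTorsionFree ℂ⟦X⟧ (E ⧸ P.toSubmodule) := by
      refine isTorsionFree_of_X fun x hx => ?_
      obtain ⟨y, rfl⟩ := P.toSubmodule.mkQ_surjective x
      rw [← map_smul, Submodule.mkQ_apply, Submodule.Quotient.mk_eq_zero] at hx
      rw [Submodule.mkQ_apply, Submodule.Quotient.mk_eq_zero]
      exact h y hx
    exact (inferInstance : Module.Free ℂ⟦X⟧ (E ⧸ P.toSubmodule))

theorem free_subquotient [Module.Finite ℂ⟦X⟧ E] {P L : ABSubmodule E} (hL : L.IsNormal) :
    Module.Free ℂ⟦X⟧ (Subquotient P L) := by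
  rw [isNormal_iff] at hL
  exact (isNormal_iff (L.within P)).2 fun x hx => hL x hx

/-- The zero sub-`(a,b)`-module. -/
noncomputable def zeroSub (E : Type*) [AddCommGroup E] [Module ℂ⟦X⟧ E] [ABStructure E] :
    ABSubmodule E where
  toSubmodule := ⊥
  a_mem x hx := by
    rw [Submodule.mem_bot] at hx ⊢
    rw [hx, map_zero]

/-- `E` as a sub-`(a,b)`-module of itself. -/
noncomputable def fullSub (E : Type*) [AddCommGroup E] [Module ℂ⟦X⟧ E] [ABStructure E] :
    ABSubmodule E where
  toSubmodule := ⊤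
  a_mem _ _ := Submodule.mem_top

theorem isIso_fullSub_zeroSub : IsIso (Subquotient (fullSub E) (zeroSub E)) E :=
  isIso_subquotient (fullSub E).toSubmodule.subtype (fun x => ⟨⟨x, trivial⟩, rfl⟩)
    (fun _ => rfl) (fun _ => Iff.rfl)

/-- The inverse image in `E` of a sub-`(a,b)`-module `Q` of a subquotient `P / L` of `E`. -/
noncomputable def liftSub {P L : ABSubmodule E} (Q : ABSubmodule (Subquotient P L)) :
    ABSubmodule E where
  toSubmodule := (Q.toSubmodule.comap (L.within P).toSubmodule.mkQ).map P.toSubmodule.subtype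
  a_mem x hx := by
    obtain ⟨y, hy, rfl⟩ := hx
    exact ⟨a y, Q.a_mem _ hy, rfl⟩

theorem mem_liftSub {P L : ABSubmodule E} {Q : ABSubmodule (Subquotient P L)} {x : E} :
    x ∈ (liftSub Q).toSubmodule ↔ ∃ h : x ∈ P.toSubmodule,
      (L.within P).toSubmodule.mkQ ⟨x, h⟩ ∈ Q.toSubmodule := by
  constructor
  · rintro ⟨y, hy, rfl⟩
    exact ⟨y.2, hy⟩
  · rintro ⟨h, hx⟩
    exact ⟨⟨x, h⟩, hx, rfl⟩

theorem liftSub_eq_left {P L : ABSubmodule E} {Q : ABSubmodule (Subquotient P L)}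
    (hQ : Q.toSubmodule = ⊤) : (liftSub Q).toSubmodule = P.toSubmodule := by
  ext x
  rw [mem_liftSub, hQ]
  exact ⟨fun h => h.1, fun h => ⟨h, trivial⟩⟩

theorem liftSub_eq_right {P L : ABSubmodule E} {Q : ABSubmodule (Subquotient P L)}
    (hLP : L.toSubmodule ≤ P.toSubmodule) (hQ : Q.toSubmodule = ⊥) :
    (liftSub Q).toSubmodule = L.toSubmodule := by
  ext x
  rw [mem_liftSub, hQ]
  constructor
  · rintro ⟨h, hx⟩
    rw [Submodule.mem_bot, Submodule.mkQ_apply, Submodule.Quotient.mk_eq_zero] at hx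
    exact hx
  · intro hx
    refine ⟨hLP hx, ?_⟩
    rw [Submodule.mem_bot, Submodule.mkQ_apply, Submodule.Quotient.mk_eq_zero]
    exact hx

theorem liftSub_lt_liftSub {P L : ABSubmodule E} {Q Q' : ABSubmodule (Subquotient P L)}
    (h : Q.toSubmodule < Q'.toSubmodule) : (liftSub Q).toSubmodule < (liftSub Q').toSubmodule := by
  obtain ⟨hle, x, hx', hx⟩ := SetLike.lt_iff_le_and_exists.1 h
  refine SetLike.lt_iff_le_and_exists.2 ⟨fun y hy => ?_, ?_⟩
  · obtain ⟨hP, hy⟩ := mem_liftSub.1 hy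
    exact mem_liftSub.2 ⟨hP, hle hy⟩
  · obtain ⟨y, rfl⟩ := (L.within P).toSubmodule.mkQ_surjective x
    exact ⟨y, mem_liftSub.2 ⟨y.2, hx'⟩, fun hy => hx (mem_liftSub.1 hy).2⟩

theorem isNormal_liftSub [Module.Finite ℂ⟦X⟧ E] {P L : ABSubmodule E}
    {Q : ABSubmodule (Subquotient P L)} (hQ : Q.IsNormal) (hP : P.IsNormal) :
    (liftSub Q).IsNormal := by
  rw [isNormal_iff] at hQ hP ⊢
  intro x hx
  obtain ⟨h, hx⟩ := mem_liftSub.1 hx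
  exact mem_liftSub.2 ⟨hP x h, hQ _ hx⟩

/-- The third isomorphism theorem: a subquotient of a subquotient of `E` is a subquotient
of `E`. -/
theorem isIso_subquotient_liftSub {P L : ABSubmodule E} (Q Q' : ABSubmodule (Subquotient P L)) :
    IsIso (Subquotient (liftSub Q') (liftSub Q)) (Subquotient Q' Q) := by
  let g : (liftSub Q').toSubmodule →ₗ[ℂ⟦X⟧] Q'.toSubmodule :=
    { toFun := fun x => ⟨(L.within P).toSubmodule.mkQ
        ⟨x, (mem_liftSub.1 x.2).1⟩, (mem_liftSub.1 x.2).2⟩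
      map_add' := fun x y => rfl
      map_smul' := fun s x => rfl }
  refine isIso_subquotient ((Q.within Q').toSubmodule.mkQ ∘ₗ g) ?_ (fun x => rfl) fun x => ?_
  · refine ((Q.within Q').toSubmodule.mkQ_surjective).comp fun y => ?_
    obtain ⟨y, hy⟩ := y
    obtain ⟨x, rfl⟩ := (L.within P).toSubmodule.mkQ_surjective y
    exact ⟨⟨x, mem_liftSub.2 ⟨x.2, hy⟩⟩, rfl⟩
  · rw [LinearMap.comp_apply, Submodule.mkQ_apply, Submodule.Quotient.mk_eq_zero,
      mem_liftSub]
    exact ⟨fun h => ⟨_, h⟩, fun h => h.2⟩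

end Iso

/-! ### Forms of a sign `ε` -/

section Form

variable {E : Type*} [AddCommGroup E] [Module ℂ⟦X⟧ E]

theorem evalNegHom_evalNegHom (s : ℂ⟦X⟧) : (evalNegHom (evalNegHom s) : ℂ⟦X⟧) = s := by
  ext n
  simp only [PowerSeries.evalNegHom, PowerSeries.coeff_rescale, ← mul_assoc, ← mul_pow]
  simp

/-- The series `S` with `Φ(v,w) = S e_0`. -/
noncomputable def pairing (Φ : E →ₗ[ℂ⟦X⟧] Conj E →ₗ[ℂ⟦X⟧] Elem 0) (v w : E) : ℂ⟦X⟧ :=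
  Elem.series 0 (Φ v (toConj E w))

variable (Φ : E →ₗ[ℂ⟦X⟧] Conj E →ₗ[ℂ⟦X⟧] Elem 0)

@[simp] theorem pairing_add_left (v v' w : E) :
    pairing Φ (v + v') w = pairing Φ v w + pairing Φ v' w := by
  simp [pairing]

@[simp] theorem pairing_add_right (v w w' : E) :
    pairing Φ v (w + w') = pairing Φ v w + pairing Φ v w' := by
  simp [pairing]

@[simp] theorem pairing_smul_left (s : ℂ⟦X⟧) (v w : E) :
    pairing Φ (s • v) w = s * pairing Φ v w := by
  simp [pairing]

@[simp] theorem pairing_smul_right (s : ℂ⟦X⟧) (v w : E) :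
    pairing Φ v (s • w) = evalNegHom s * pairing Φ v w := by
  have h : toConj E (s • w) = (evalNegHom s : ℂ⟦X⟧) • toConj E w := by
    rw [smul_toConj, evalNegHom_evalNegHom]
  rw [pairing, h, map_smul, map_smul, smul_eq_mul, pairing]

@[simp] theorem pairing_zero_left (w : E) : pairing Φ 0 w = 0 := by
  simp [pairing]

theorem pairing_sub_left (v v' w : E) :
    pairing Φ (v - v') w = pairing Φ v w - pairing Φ v' w := by
  simp [pairing]

/-- The linear form `w ↦ Φ(w, v)`. -/
noncomputable def pairingLeft (v : E) : E →ₗ[ℂ⟦X⟧] ℂ⟦X⟧ where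
  toFun w := pairing Φ w v
  map_add' w w' := pairing_add_left Φ w w' v
  map_smul' s w := pairing_smul_left Φ s w v

/-- The linear form `w ↦ f(w)(-b) e_0` on the conjugate of `E`. -/
noncomputable def conjForm (f : E →ₗ[ℂ⟦X⟧] ℂ⟦X⟧) : Conj E →ₗ[ℂ⟦X⟧] Elem 0 where
  toFun w := (Elem.series 0).symm (evalNegHom (f ((toConj E).symm w)))
  map_add' w w' := by simp only [map_add]
  map_smul' s w := by
    obtain ⟨w, rfl⟩ := (toConj E).surjective w
    rw [smul_toConj, AddEquiv.symm_apply_apply, AddEquiv.symm_apply_apply, map_smul, smul_eq_mul,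
      map_mul, evalNegHom_evalNegHom, RingHom.id_apply, ← smul_eq_mul, map_smul]

variable [ABStructure E]

/-- Non-degenerate forms with `Φ(w,v) = ε S(-b) e_0` when `Φ(v,w) = S(b) e_0`: hermitian ones for
`ε = 1` and anti-hermitian ones for `ε = -1`. -/
structure IsSignedForm (ε : ℂ) (Φ : E →ₗ[ℂ⟦X⟧] Conj E →ₗ[ℂ⟦X⟧] Elem 0) : Prop where
  sign : ε * ε = 1
  bilinear : IsABBilinear Φ
  symm : ∀ v w : E, pairing Φ w v = C ε * evalNegHom (pairing Φ v w)
  nondegenerate : IsNondegenerate Φ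

variable {Φ}

theorem IsABBilinear.pairing_a_left (h : IsABBilinear Φ) (v w : E) : pairing Φ (a v) w =
    X ^ 2 * PowerSeries.derivative ℂ (pairing Φ v w) + pairing Φ v (a w) := by
  have e := congrArg (Elem.series 0) (h v (toConj E w))
  rw [series_a, a_toConj, map_neg, map_neg, map_add, map_neg, map_zero, zero_mul, zero_mul,
    zero_add] at e
  simp only [pairing]
  rw [e]
  ring

namespace IsSignedForm

variable {ε : ℂ} (h : IsSignedForm ε Φ)
include h

theorem C_mul_C : (C ε * C ε : ℂ⟦X⟧) = 1 := by
  rw [← map_mul, h.sign, map_one]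

theorem pairing_eq_zero_comm {v w : E} (hvw : pairing Φ v w = 0) : pairing Φ w v = 0 := by
  rw [h.symm, hvw, map_zero, mul_zero]

theorem eq_zero {v : E} (hv : ∀ w, pairing Φ v w = 0) : v = 0 := by
  refine h.nondegenerate.1 ?_
  rw [map_zero]
  refine LinearMap.ext fun w => ?_
  exact hv w

/-- Every linear form on `E` is `Φ(·, v)` for some `v`. -/
theorem exists_pairing (f : E →ₗ[ℂ⟦X⟧] ℂ⟦X⟧) : ∃ v, ∀ w, pairing Φ w v = f w := by
  obtain ⟨v, hv⟩ := h.nondegenerate.2 (conjForm ((C ε : ℂ⟦X⟧) • f))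
  refine ⟨v, fun w => ?_⟩
  have e : pairing Φ v w = evalNegHom ((C ε : ℂ⟦X⟧) * f w) :=
    congrArg (Elem.series 0) (LinearMap.congr_fun hv (toConj E w))
  rw [h.symm v w, e, evalNegHom_evalNegHom, ← mul_assoc, h.C_mul_C, one_mul]

/-- A module with a non-degenerate (anti-)hermitian form is self-adjoint, through
`v ↦ Φ(·, v)`. -/
theorem isSelfAdjoint : IsSelfAdjoint E := by
  let f : E →ₗ[ℂ⟦X⟧] Adjoint E :=
    { toFun := fun v => toConj (Dual E) (Φ.flip (toConj E v))
      map_add' := fun v w => by rw [map_add, map_add, map_add]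
      map_smul' := fun s v => by
        have e : toConj E (s • v) = (evalNegHom s : ℂ⟦X⟧) • toConj E v := by
          rw [smul_toConj, evalNegHom_evalNegHom]
        rw [e, map_smul, RingHom.id_apply, smul_toConj] }
  have hf : ∀ v w, Elem.series 0 (((toConj (Dual E)).symm (f v) : Dual E) w) = pairing Φ w v :=
    fun v w => rfl
  refine ⟨LinearEquiv.ofBijective f ⟨?_, fun φ => ?_⟩, fun v => ?_⟩
  · rw [← LinearMap.ker_eq_bot, LinearMap.ker_eq_bot']
    intro v hv
    refine h.eq_zero fun w => h.pairing_eq_zero_comm ?_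
    rw [← hf, hv]
    rfl
  · obtain ⟨v, hv⟩ := h.exists_pairing
      ((Elem.series 0 : Elem 0 →ₗ[ℂ⟦X⟧] ℂ⟦X⟧) ∘ₗ ((toConj (Dual E)).symm φ : Dual E))
    refine ⟨v, LinearMap.ext fun w => (Elem.series 0).injective ?_⟩
    exact hv w
  · refine LinearMap.ext fun w => (Elem.series 0).injective ?_
    change pairing Φ w (a v) =
      Elem.series 0 (-(a (Φ w (toConj E v)) - Φ (a w) (toConj E v)))
    rw [map_neg, map_sub, series_a, map_zero, zero_mul, zero_mul, zero_add]
    have e := h.bilinear.pairing_a_left w v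
    simp only [pairing] at e ⊢
    rw [e]
    ring

end IsSignedForm

end Form

/-! ### Isotropic eigenvectors -/

section Isotropic

variable {E : Type*} [AddCommGroup E] [Module ℂ⟦X⟧ E]

theorem eq_C_mul_X_pow_of_derivative {S : ℂ⟦X⟧} {m : ℂ} (hS : S ≠ 0)
    (h : X * PowerSeries.derivative ℂ S = C m * S) :
    ∃ (k : ℕ) (c : ℂ), c ≠ 0 ∧ m = k ∧ S = C c * X ^ k := by
  have hcoeff : ∀ n : ℕ, (n : ℂ) * PowerSeries.coeff n S = m * PowerSeries.coeff n S := by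
    intro n
    have e := congrArg (PowerSeries.coeff n) h
    rw [PowerSeries.coeff_C_mul] at e
    rw [← e]
    rcases n with _ | n
    · simp
    · rw [PowerSeries.coeff_succ_X_mul, PowerSeries.coeff_derivative]
      push_cast
      ring
  obtain ⟨k, hk⟩ : ∃ k, PowerSeries.coeff k S ≠ 0 := by
    by_contra! h0
    exact hS (PowerSeries.ext h0)
  have hm : m = k := (mul_right_cancel₀ hk (hcoeff k)).symm
  refine ⟨k, _, hk, hm, ?_⟩
  ext n
  rw [PowerSeries.coeff_C_mul_X_pow]
  split_ifs with hn
  · rw [hn]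
  · by_contra hn0
    have e := mul_right_cancel₀ hn0 (hcoeff n)
    rw [hm] at e
    exact hn (by exact_mod_cast e)

variable [ABStructure E]

theorem a_X_pow_smul [Module.Free ℂ⟦X⟧ E] (k : ℕ) (x : E) :
    a ((X ^ k : ℂ⟦X⟧) • x) = (X ^ k : ℂ⟦X⟧) • (a x + (C (k : ℂ) * X : ℂ⟦X⟧) • x) := by
  rw [a_smul, PowerSeries.derivative_pow, PowerSeries.derivative_X, map_natCast]
  rcases k with _ | k
  · simp
  · simp only [Nat.add_sub_cancel]
    module

/-- An eigenvector of parameter `l`, multiplied by `b ^ k`, has parameter `l + k`. -/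
theorem a_X_pow_smul_of_eigenvector [Module.Free ℂ⟦X⟧ E] {l : ℂ} {x : E}
    (hx : a x = (C l * X : ℂ⟦X⟧) • x) (k : ℕ) :
    a ((X ^ k : ℂ⟦X⟧) • x) = (C (l + k) * X : ℂ⟦X⟧) • (X ^ k : ℂ⟦X⟧) • x := by
  rw [a_X_pow_smul, hx, map_add]
  module

/-- Dividing an eigenvector by the highest possible power of `b`. -/
theorem exists_primitive_eigenvector [Module.Free ℂ⟦X⟧ E] [Module.Finite ℂ⟦X⟧ E] {l : ℂ} {x : E}
    (hx : a x = (C l * X : ℂ⟦X⟧) • x) (h0 : x ≠ 0) :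
    ∃ (k : ℕ) (m : ℂ) (e : E), x = (X ^ k : ℂ⟦X⟧) • e ∧ (∀ z : E, e ≠ (X : ℂ⟦X⟧) • z) ∧
      a e = (C m * X : ℂ⟦X⟧) • e := by
  obtain ⟨k, e, rfl, he⟩ := exists_eq_X_pow_smul h0
  refine ⟨k, l - k, e, rfl, he, X_pow_smul_injective k ?_⟩
  rw [a_X_pow_smul, smul_add, ← eq_sub_iff_add_eq] at hx
  rw [hx, map_sub]
  module

namespace IsSignedForm

variable {Φ : E →ₗ[ℂ⟦X⟧] Conj E →ₗ[ℂ⟦X⟧] Elem 0} {ε : ℂ} (h : IsSignedForm ε Φ)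
include h

/-- The series `S` of `Φ(x,x)` satisfies `b S' = 2 l S` when `a x = l b x`. -/
theorem derivative_pairing_self {l : ℂ} {x : E} (hx : a x = (C l * X : ℂ⟦X⟧) • x) :
    X * PowerSeries.derivative ℂ (pairing Φ x x) = C (2 * l) * pairing Φ x x := by
  have e := h.bilinear.pairing_a_left x x
  rw [hx, pairing_smul_left, pairing_smul_right, map_mul, evalNegHom_C,
    PowerSeries.evalNegHom_X] at e
  refine mul_left_cancel₀ (PowerSeries.X_ne_zero (R := ℂ)) ?_
  rw [two_mul, map_add]
  linear_combination -e

theorem pairing_self_of_eigenvector {l : ℂ} {x : E} (hx : a x = (C l * X : ℂ⟦X⟧) • x)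
    (h0 : pairing Φ x x ≠ 0) :
    ∃ (k : ℕ) (c : ℂ), c ≠ 0 ∧ 2 * l = k ∧ pairing Φ x x = C c * X ^ k ∧ ε * (-1) ^ k = 1 := by
  obtain ⟨k, c, hc, hk, hS⟩ := eq_C_mul_X_pow_of_derivative h0 (h.derivative_pairing_self hx)
  refine ⟨k, c, hc, hk, hS, ?_⟩
  have e := h.symm x x
  rw [hS, map_mul, evalNegHom_C, map_pow, PowerSeries.evalNegHom_X, neg_pow] at e
  have hX : (C c * X ^ k : ℂ⟦X⟧) ≠ 0 := hS ▸ h0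
  refine PowerSeries.C_injective (mul_left_cancel₀ hX ?_)
  rw [map_mul, map_pow, map_neg, map_one]
  linear_combination -e

/-- Two orthogonal eigenvectors that are not isotropic combine to an isotropic one: the exponents
of their squares have the same parity, so multiplying one of them by a power of `b` makes the
parameters agree, and over `ℂ` the binary form on their span is isotropic. -/
theorem exists_isotropic_of_orthogonal [Module.Free ℂ⟦X⟧ E] {l m : ℂ} {x y : E}
    (hx : a x = (C l * X : ℂ⟦X⟧) • x) (hy : a y = (C m * X : ℂ⟦X⟧) • y)
    (hxx : pairing Φ x x ≠ 0) (hyy : pairing Φ y y ≠ 0) (hyx : pairing Φ y x = 0) :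
    ∃ (r : ℂ) (z : E), z ≠ 0 ∧ a z = (C r * X : ℂ⟦X⟧) • z ∧ pairing Φ z z = 0 := by
  obtain ⟨k, c, hc, hk, hxS, hkε⟩ := h.pairing_self_of_eigenvector hx hxx
  obtain ⟨j, d, hd, hj, hyS, hjε⟩ := h.pairing_self_of_eigenvector hy hyy
  have hxy := h.pairing_eq_zero_comm hyx
  wlog hkj : k ≤ j generalizing x y l m k j c d
  · exact this hy hx hyy hxx hxy j d hd hj hyS hjε k c hc hk hxS hkε hyx (le_of_not_ge hkj)
  obtain ⟨i, rfl⟩ := Nat.exists_eq_add_of_le hkj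
  have hi : Even i := by
    have e : ((-1 : ℂ)) ^ i = 1 := by
      rw [pow_add, ← mul_assoc, hkε, one_mul] at hjε
      exact hjε
    exact (neg_one_pow_eq_one_iff_even (by norm_num)).1 e
  obtain ⟨i, rfl⟩ := hi
  obtain ⟨t, ht⟩ := IsAlgClosed.exists_pow_nat_eq (-((-1) ^ i * c / d)) (n := 2) two_pos
  have hm : l + i = m := by
    push_cast at hj
    linear_combination (hk - hj) / 2
  refine ⟨m, (X ^ i : ℂ⟦X⟧) • x + (C t : ℂ⟦X⟧) • y, ?_, ?_, ?_⟩
  · intro hz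
    have e := congrArg (fun z => pairing Φ z x) hz
    simp only [pairing_add_left, pairing_smul_left, hyx, mul_zero, add_zero,
      pairing_zero_left] at e
    exact mul_ne_zero (pow_ne_zero i PowerSeries.X_ne_zero) hxx e
  · rw [map_add, a_X_pow_smul_of_eigenvector hx, hm, ABStructure.a_const_smul, hy]
    module
  · simp only [pairing_add_left, pairing_add_right, pairing_smul_left, pairing_smul_right, hxy,
      hyx, hxS, hyS, mul_zero, add_zero, zero_add, map_pow, PowerSeries.evalNegHom_X, evalNegHom_C]
    have e : (C t * C t : ℂ⟦X⟧) * C d = -((-1) ^ i * C c) := by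
      rw [← map_mul, ← map_mul, ← pow_two, ht, ← map_one (C (R := ℂ)), ← map_neg, ← map_pow,
        ← map_mul, ← map_neg]
      congr 1
      field_simp
    rw [neg_pow, pow_add X k, pow_add X i]
    linear_combination X ^ k * (X ^ i * X ^ i) * e

theorem exists_isotropic_eigenvector [Module.Free ℂ⟦X⟧ E] [Module.Finite ℂ⟦X⟧ E]
    {R : Submodule ℂ⟦X⟧ E} (hR : IsSimplePole R) {N : ℕ}
    (hN : ∀ x : E, (X ^ N : ℂ⟦X⟧) • x ∈ R) (hrank : 2 ≤ Module.finrank ℂ⟦X⟧ E) :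
    ∃ (r : ℂ) (z : E), z ≠ 0 ∧ a z = (C r * X : ℂ⟦X⟧) • z ∧ pairing Φ z z = 0 := by
  have hR0 : ∀ P : Submodule ℂ⟦X⟧ E, P ≠ ⊥ → R ⊓ P ≠ ⊥ := by
    intro P hP
    obtain ⟨y, hyP, hy⟩ := P.exists_mem_ne_zero_of_ne_bot hP
    refine (Submodule.ne_bot_iff _).2 ⟨(X ^ N : ℂ⟦X⟧) • y, ⟨hN y, P.smul_mem _ hyP⟩, fun h0 => ?_⟩
    exact hy (X_pow_smul_injective N (h0.trans (smul_zero _).symm))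
  have hE : Nontrivial E := Module.nontrivial_of_finrank_pos (R := ℂ⟦X⟧) (by omega)
  obtain ⟨l, x, -, hx0, hx⟩ := hR.exists_eigenvector
    (by simpa using hR0 ⊤ top_ne_bot)
  by_cases hxx : pairing Φ x x = 0
  · exact ⟨l, x, hx0, hx, hxx⟩
  -- the orthogonal of `x` is nonzero since the rank is at least two, and stable under `b⁻¹ a`
  have hP : LinearMap.ker (pairingLeft Φ x) ≠ ⊥ := by
    intro hP
    have e := LinearMap.finrank_le_finrank_of_injective (LinearMap.ker_eq_bot.1 hP)
    rw [Module.finrank_self] at e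
    omega
  have hRP : IsSimplePole (R ⊓ LinearMap.ker (pairingLeft Φ x)) := by
    rintro y ⟨hyR, hyP⟩
    obtain ⟨z, hzR, hz⟩ := hR y hyR
    refine ⟨z, ⟨hzR, ?_⟩, hz⟩
    change pairing Φ y x = 0 at hyP
    change pairing Φ z x = 0
    have e := h.bilinear.pairing_a_left y x
    rw [hz, hx, pairing_smul_left, pairing_smul_right, hyP, map_zero, mul_zero, mul_zero,
      add_zero] at e
    exact (mul_eq_zero.1 e).resolve_left PowerSeries.X_ne_zero
  obtain ⟨m, y, ⟨-, hyP⟩, hy0, hy⟩ := hRP.exists_eigenvector (hR0 _ hP)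
  by_cases hyy : pairing Φ y y = 0
  · exact ⟨m, y, hy0, hy, hyy⟩
  exact h.exists_isotropic_of_orthogonal hx hy hxx hyy hyP

theorem exists_primitive_isotropic [Module.Free ℂ⟦X⟧ E] [Module.Finite ℂ⟦X⟧ E]
    {R : Submodule ℂ⟦X⟧ E} (hR : IsSimplePole R) {N : ℕ}
    (hN : ∀ x : E, (X ^ N : ℂ⟦X⟧) • x ∈ R) (hrank : 2 ≤ Module.finrank ℂ⟦X⟧ E) :
    ∃ (l : ℂ) (e : E), a e = (C l * X : ℂ⟦X⟧) • e ∧ (∀ z : E, e ≠ (X : ℂ⟦X⟧) • z) ∧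
      pairing Φ e e = 0 := by
  obtain ⟨r, z, hz0, hz, hzz⟩ := h.exists_isotropic_eigenvector hR hN hrank
  obtain ⟨k, l, e, rfl, hprim, he⟩ := exists_primitive_eigenvector hz hz0
  refine ⟨l, e, he, hprim, ?_⟩
  rw [pairing_smul_left, pairing_smul_right, map_pow, PowerSeries.evalNegHom_X] at hzz
  have hX : (X : ℂ⟦X⟧) ≠ 0 := PowerSeries.X_ne_zero
  exact (mul_eq_zero.1 ((mul_eq_zero.1 hzz).resolve_left (pow_ne_zero k hX))).resolve_left
    (pow_ne_zero k (neg_ne_zero.2 hX))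

/-- A vector not divisible by `b` takes part in a pairing with value `1`. -/
theorem exists_pairing_eq_one [Module.Free ℂ⟦X⟧ E] [Module.Finite ℂ⟦X⟧ E] {e : E}
    (he : ∀ z : E, e ≠ (X : ℂ⟦X⟧) • z) : ∃ v, pairing Φ v e = 1 := by
  have B := Module.Free.chooseBasis ℂ⟦X⟧ E
  obtain ⟨i, hi⟩ : ∃ i, IsUnit (B.repr e i) := by
    by_contra! hi
    have hi' : ∀ i, ∃ t, B.repr e i = X * t := fun i => PowerSeries.X_dvd_iff.2 (by
      have := hi i
      rw [PowerSeries.isUnit_iff_constantCoeff, isUnit_iff_ne_zero, not_not] at this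
      exact this)
    choose t ht using hi'
    refine he (B.equivFun.symm t) (B.equivFun.injective (funext fun i => ?_))
    rw [map_smul, LinearEquiv.apply_symm_apply, B.equivFun_apply, ht]
    rfl
  obtain ⟨u, hu⟩ := hi.exists_left_inv
  obtain ⟨v, hv⟩ := h.exists_pairing (u • B.coord i)
  refine ⟨(C ε : ℂ⟦X⟧) • v, ?_⟩
  have e1 : pairing Φ e v = 1 := by
    rw [hv, LinearMap.smul_apply, B.coord_apply, smul_eq_mul, hu]
  rw [pairing_smul_left, h.symm e v, e1, map_one, mul_one, h.C_mul_C]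

end IsSignedForm

end Isotropic

/-! ### Isotropic lines and their orthogonals -/

section Line

variable {E : Type*} [AddCommGroup E] [Module ℂ⟦X⟧ E] [ABStructure E]

theorem ABSubmodule.ext_toSubmodule {P Q : ABSubmodule E} (h : P.toSubmodule = Q.toSubmodule) :
    P = Q := by
  cases P
  cases Q
  cases h
  rfl

/-- The sub-`(a,b)`-module generated by an eigenvector. -/
noncomputable def lineSub [Module.Free ℂ⟦X⟧ E] {l : ℂ} {e : E}
    (he : a e = (C l * X : ℂ⟦X⟧) • e) : ABSubmodule E where
  toSubmodule := Submodule.span ℂ⟦X⟧ {e}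
  a_mem x hx := by
    obtain ⟨s, rfl⟩ := Submodule.mem_span_singleton.1 hx
    rw [a_smul, he, smul_smul, ← add_smul]
    exact Submodule.smul_mem _ _ (Submodule.mem_span_singleton_self e)

section

variable [Module.Free ℂ⟦X⟧ E] {l : ℂ} {e : E}
  (he : a e = (C l * X : ℂ⟦X⟧) • e)

theorem mem_lineSub {x : E} : x ∈ (lineSub he).toSubmodule ↔ ∃ s : ℂ⟦X⟧, s • e = x :=
  Submodule.mem_span_singleton

theorem isNormal_lineSub [Module.Finite ℂ⟦X⟧ E] (hprim : ∀ z : E, e ≠ (X : ℂ⟦X⟧) • z) :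
    (lineSub he).IsNormal := by
  refine (isNormal_iff _).2 fun x hx => ?_
  obtain ⟨s, hs⟩ := (mem_lineSub he).1 hx
  obtain ⟨t, c, rfl⟩ := exists_eq_X_mul_add_C s
  by_cases hc : c = 0
  · refine (mem_lineSub he).2 ⟨t, X_smul_injective ?_⟩
    rw [← hs, hc, map_zero, add_zero, mul_smul]
  · obtain ⟨u, hu⟩ := (isUnit_X_mul_add_C t hc).exists_left_inv
    refine (hprim (u • x) ?_).elim
    rw [smul_comm, ← hs, smul_smul, hu, one_smul]

theorem isIso_lineSub (h0 : e ≠ 0) : IsIso (Subquotient (lineSub he) (zeroSub E)) (Elem l) := by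
  let g : Elem l ≃ₗ[ℂ⟦X⟧] (lineSub he).toSubmodule :=
    (Elem.series l).trans (LinearEquiv.toSpanNonzeroSingleton ℂ⟦X⟧ E e h0)
  have hg : ∀ s, (g s : E) = Elem.series l s • e := fun s => rfl
  have hga : ∀ s, g (a s) = a (g s) := by
    intro s
    ext
    change (g (a s) : E) = a (g s : E)
    rw [hg, hg, a_smul, he, series_a]
    module
  refine isIso_subquotient (g.symm : (lineSub he).toSubmodule →ₗ[ℂ⟦X⟧] Elem l) g.symm.surjective
    (fun x => ?_) (fun x => ?_)
  · refine g.injective ?_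
    rw [hga]
    simp
  · change g.symm x = 0 ↔ (x : E) = 0
    rw [LinearEquiv.map_eq_zero_iff, Submodule.coe_eq_zero]

theorem finrank_lineSub (h0 : e ≠ 0) : Module.finrank ℂ⟦X⟧ (lineSub he).toSubmodule = 1 := by
  rw [← Module.finrank_self ℂ⟦X⟧]
  exact (LinearEquiv.toSpanNonzeroSingleton ℂ⟦X⟧ E e h0).finrank_eq.symm

end

variable {Φ : E →ₗ[ℂ⟦X⟧] Conj E →ₗ[ℂ⟦X⟧] Elem 0} (hΦ : IsABBilinear Φ) {l : ℂ} {e : E}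
  (he : a e = (C l * X : ℂ⟦X⟧) • e)

theorem IsABBilinear.pairing_a_eigenvector (hΦ : IsABBilinear Φ)
    (he : a e = (C l * X : ℂ⟦X⟧) • e) (x : E) :
    pairing Φ (a x) e = C (-l) * X * pairing Φ x e +
      X ^ 2 * PowerSeries.derivative ℂ (pairing Φ x e) := by
  rw [hΦ.pairing_a_left, he, pairing_smul_right, map_mul, evalNegHom_C, PowerSeries.evalNegHom_X,
    map_neg]
  ring

/-- The orthogonal of an eigenvector. -/
noncomputable def orthSub : ABSubmodule E where
  toSubmodule := LinearMap.ker (pairingLeft Φ e)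
  a_mem x hx := by
    change pairing Φ x e = 0 at hx
    change pairing Φ (a x) e = 0
    rw [hΦ.pairing_a_eigenvector he, hx, map_zero, mul_zero, mul_zero, add_zero]

theorem mem_orthSub {x : E} : x ∈ (orthSub hΦ he).toSubmodule ↔ pairing Φ x e = 0 := Iff.rfl

theorem isNormal_orthSub [Module.Finite ℂ⟦X⟧ E] : (orthSub hΦ he).IsNormal := by
  refine (isNormal_iff _).2 fun x hx => ?_
  rw [mem_orthSub, pairing_smul_left] at hx
  exact (mul_eq_zero.1 hx).resolve_left PowerSeries.X_ne_zero

/-- The quotient by the orthogonal of a line with parameter `l` is, through the form, the adjoint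
of the line: it has parameter `-l`. -/
theorem isIso_quotient_orthSub {v : E} (hv : pairing Φ v e = 1) :
    IsIso (Subquotient (fullSub E) (orthSub hΦ he)) (Elem (-l)) := by
  refine isIso_subquotient (((Elem.series (-l)).symm : ℂ⟦X⟧ →ₗ[ℂ⟦X⟧] Elem (-l)) ∘ₗ
    pairingLeft Φ e ∘ₗ (fullSub E).toSubmodule.subtype) (fun s => ?_) (fun x => ?_) (fun x => ?_)
  · refine ⟨⟨Elem.series (-l) s • v, trivial⟩, (Elem.series (-l)).injective ?_⟩
    change pairing Φ (Elem.series (-l) s • v) e = _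
    rw [pairing_smul_left, hv, mul_one]
  · refine (Elem.series (-l)).injective ?_
    rw [series_a]
    exact hΦ.pairing_a_eigenvector he x
  · exact (Elem.series (-l)).symm.map_eq_zero_iff

theorem finrank_orthSub [Module.Finite ℂ⟦X⟧ E] {v : E} (hv : pairing Φ v e = 1) :
    Module.finrank ℂ⟦X⟧ (orthSub hΦ he).toSubmodule + 1 = Module.finrank ℂ⟦X⟧ E := by
  have hsurj : Function.Surjective (pairingLeft Φ e) := fun s => ⟨s • v, by
    change pairing Φ (s • v) e = s
    rw [pairing_smul_left, hv, mul_one]⟩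
  rw [← Submodule.finrank_quotient_add_finrank (orthSub hΦ he).toSubmodule, add_comm]
  congr 1
  rw [← Module.finrank_self ℂ⟦X⟧]
  exact ((pairingLeft Φ e).quotKerEquivOfSurjective hsurj).finrank_eq.symm

end Line

/-! ### The form induced on a subquotient -/

section Descent

variable {E : Type*} [AddCommGroup E] [Module ℂ⟦X⟧ E] [ABStructure E]

theorem finrank_submoduleOf {E : Type*} [AddCommGroup E] [Module ℂ⟦X⟧ E]
    {L P : Submodule ℂ⟦X⟧ E} (h : L ≤ P) :
    Module.finrank ℂ⟦X⟧ (L.submoduleOf P) = Module.finrank ℂ⟦X⟧ L :=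
  (Submodule.submoduleOfEquivOfLe h).finrank_eq

/-- A form descends to `P / L` when `L` is orthogonal to `P` on both sides. -/
theorem exists_form_subquotient (Φ : E →ₗ[ℂ⟦X⟧] Conj E →ₗ[ℂ⟦X⟧] Elem 0) (P L : ABSubmodule E)
    (hl : ∀ x ∈ L.toSubmodule, ∀ y ∈ P.toSubmodule, pairing Φ x y = 0)
    (hr : ∀ x ∈ L.toSubmodule, ∀ y ∈ P.toSubmodule, pairing Φ y x = 0) :
    ∃ Ψ : Subquotient P L →ₗ[ℂ⟦X⟧] Conj (Subquotient P L) →ₗ[ℂ⟦X⟧] Elem 0,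
      ∀ v w : P.toSubmodule, Ψ ((L.within P).toSubmodule.mkQ v)
        (toConj _ ((L.within P).toSubmodule.mkQ w)) = Φ v (toConj E w) := by
  let p := (L.within P).toSubmodule.mkQ
  have hp : Function.Surjective p := (L.within P).toSubmodule.mkQ_surjective
  let σ := Function.surjInv hp
  let f : Subquotient P L → Conj (Subquotient P L) → Elem 0 :=
    fun v w => Φ (σ v) (toConj E (σ ((toConj _).symm w)))
  have hσ : ∀ v : P.toSubmodule, ((σ (p v) - v : P.toSubmodule) : E) ∈ L.toSubmodule := by
    intro v
    have e : p (σ (p v) - v) = 0 := by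
      rw [map_sub, Function.surjInv_eq hp, sub_self]
    exact (Submodule.Quotient.mk_eq_zero (L.within P).toSubmodule).1 e
  have hf : ∀ v w : P.toSubmodule, f (p v) (toConj _ (p w)) = Φ v (toConj E w) := by
    intro v w
    have e1 := hl _ (hσ v) _ (σ (p w)).2
    have e2 := hr _ (hσ w) _ v.2
    refine (Elem.series 0).injective ?_
    simp only [pairing, Submodule.coe_sub, map_sub, LinearMap.sub_apply, sub_eq_zero] at e1 e2
    exact e1.trans e2
  have hc : ∀ (s : ℂ⟦X⟧) (w : P.toSubmodule), s • toConj (Subquotient P L) (p w) =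
      toConj _ (p ((evalNegHom s : ℂ⟦X⟧) • w)) := fun s w => rfl
  refine ⟨LinearMap.mk₂ ℂ⟦X⟧ f ?_ ?_ ?_ ?_, fun v w => hf v w⟩
  · intro v v' w
    obtain ⟨v, rfl⟩ := hp v
    obtain ⟨v', rfl⟩ := hp v'
    obtain ⟨w, rfl⟩ := (toConj _).surjective w
    obtain ⟨w, rfl⟩ := hp w
    rw [← map_add, hf, hf, hf, Submodule.coe_add, map_add, LinearMap.add_apply]
  · intro s v w
    obtain ⟨v, rfl⟩ := hp v
    obtain ⟨w, rfl⟩ := (toConj _).surjective w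
    obtain ⟨w, rfl⟩ := hp w
    rw [← map_smul, hf, hf, Submodule.coe_smul, map_smul, LinearMap.smul_apply]
  · intro v w w'
    obtain ⟨v, rfl⟩ := hp v
    obtain ⟨w, rfl⟩ := (toConj _).surjective w
    obtain ⟨w, rfl⟩ := hp w
    obtain ⟨w', rfl⟩ := (toConj _).surjective w'
    obtain ⟨w', rfl⟩ := hp w'
    rw [← map_add, ← map_add, hf, hf, hf, Submodule.coe_add, map_add, map_add]
  · intro s v w
    obtain ⟨v, rfl⟩ := hp v
    obtain ⟨w, rfl⟩ := (toConj _).surjective w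
    obtain ⟨w, rfl⟩ := hp w
    rw [hc, hf, hf, Submodule.coe_smul, ← smul_toConj, map_smul]

/-- For an isotropic line `L` generated by `e`, with orthogonal `P`, the form induces a
non-degenerate form of the same sign on `P / L`. -/
theorem IsSignedForm.exists_reduction {Φ : E →ₗ[ℂ⟦X⟧] Conj E →ₗ[ℂ⟦X⟧] Elem 0} {ε : ℂ}
    (h : IsSignedForm ε Φ) {P L : ABSubmodule E} {e v : E}
    (hP : ∀ x, x ∈ P.toSubmodule ↔ pairing Φ x e = 0)
    (hL : ∀ x, x ∈ L.toSubmodule ↔ ∃ s : ℂ⟦X⟧, s • e = x)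
    (hee : pairing Φ e e = 0) (hv : pairing Φ v e = 1) :
    ∃ Ψ : Subquotient P L →ₗ[ℂ⟦X⟧] Conj (Subquotient P L) →ₗ[ℂ⟦X⟧] Elem 0,
      IsSignedForm ε Ψ := by
  have hl : ∀ x ∈ L.toSubmodule, ∀ y ∈ P.toSubmodule, pairing Φ y x = 0 := by
    intro x hx y hy
    obtain ⟨s, rfl⟩ := (hL x).1 hx
    rw [pairing_smul_right, (hP y).1 hy, mul_zero]
  obtain ⟨Ψ, hΨ⟩ := exists_form_subquotient Φ P L
    (fun x hx y hy => h.pairing_eq_zero_comm (hl x hx y hy)) hl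
  have hp : Function.Surjective (L.within P).toSubmodule.mkQ :=
    (L.within P).toSubmodule.mkQ_surjective
  have hpair : ∀ v w : P.toSubmodule, pairing Ψ ((L.within P).toSubmodule.mkQ v)
      ((L.within P).toSubmodule.mkQ w) = pairing Φ v w := fun v w =>
    congrArg (Elem.series 0) (hΨ v w)
  have hev : pairing Φ e v = C ε := by
    rw [h.symm v e, hv, map_one, mul_one]
  have heP : e ∈ P.toSubmodule := (hP e).2 hee
  -- `E` is the direct sum of `P` and the line of `v`
  have hdec : ∀ x : E, x - pairing Φ x e • v ∈ P.toSubmodule := by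
    intro x
    rw [hP, pairing_sub_left, pairing_smul_left, hv, mul_one, sub_self]
  refine ⟨Ψ, h.sign, fun x y => ?_, fun x y => ?_, ?_, fun φ => ?_⟩
  · obtain ⟨x, rfl⟩ := hp x
    obtain ⟨y, rfl⟩ := (toConj _).surjective y
    obtain ⟨y, rfl⟩ := hp y
    have ex : a ((L.within P).toSubmodule.mkQ x) = (L.within P).toSubmodule.mkQ (a x) := rfl
    have ey : a (toConj _ ((L.within P).toSubmodule.mkQ y)) =
      toConj _ ((L.within P).toSubmodule.mkQ (-a y)) := rfl
    rw [ex, ey, hΨ, hΨ, hΨ]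
    exact h.bilinear x (toConj E y)
  · obtain ⟨x, rfl⟩ := hp x
    obtain ⟨y, rfl⟩ := hp y
    rw [hpair, hpair]
    exact h.symm x y
  · refine (injective_iff_map_eq_zero Ψ.toAddMonoidHom).2 ?_
    intro x hx
    obtain ⟨x, rfl⟩ := hp x
    have hx' : ∀ y ∈ P.toSubmodule, pairing Φ x y = 0 := by
      intro y hy
      rw [← hpair x ⟨y, hy⟩]
      exact congrArg (Elem.series 0)
        (LinearMap.congr_fun hx (toConj _ ((L.within P).toSubmodule.mkQ ⟨y, hy⟩)))
    -- subtracting a multiple of `e` makes `x` orthogonal to `v` too, hence zero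
    have hz : (x : E) - (C ε * pairing Φ x v) • e = 0 := by
      refine h.eq_zero fun w => ?_
      have e1 : pairing Φ ((x : E) - (C ε * pairing Φ x v) • e) v = 0 := by
        rw [pairing_sub_left, pairing_smul_left, hev]
        linear_combination -pairing Φ x v * h.C_mul_C
      have e2 : pairing Φ ((x : E) - (C ε * pairing Φ x v) • e) (w - pairing Φ w e • v) = 0 := by
        rw [pairing_sub_left, pairing_smul_left, hx' _ (hdec w),
          h.pairing_eq_zero_comm ((hP _).1 (hdec w)), mul_zero, sub_self]
      have e3 : w = (w - pairing Φ w e • v) + pairing Φ w e • v := by abel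
      rw [e3, pairing_add_right, e2, pairing_smul_right, e1, mul_zero, add_zero]
    refine (Submodule.Quotient.mk_eq_zero _).2 ?_
    exact (hL _).2 ⟨_, (sub_eq_zero.1 hz).symm⟩
  · -- extend the functional by zero on the line of `v`
    let f : E →ₗ[ℂ⟦X⟧] P.toSubmodule :=
      { toFun := fun x => ⟨x - pairing Φ x e • v, hdec x⟩
        map_add' := fun x y => by
          ext
          simp only [pairing_add_left, Submodule.coe_add]
          module
        map_smul' := fun s x => by
          ext
          simp only [pairing_smul_left, Submodule.coe_smul, RingHom.id_apply]
          module }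
    have hfP : ∀ x : P.toSubmodule, f x = x := by
      intro x
      ext
      change (x : E) - pairing Φ x e • v = x
      rw [(hP _).1 x.2, zero_smul, sub_zero]
    let F : E →ₗ[ℂ⟦X⟧] ℂ⟦X⟧ :=
      { toFun := fun x => C ε * evalNegHom (Elem.series 0
          (φ (toConj _ ((L.within P).toSubmodule.mkQ (f x)))))
        map_add' := fun x y => by simp only [map_add, mul_add]
        map_smul' := fun s x => by
          have e1 : toConj _ (s • (L.within P).toSubmodule.mkQ (f x)) =
              (evalNegHom s : ℂ⟦X⟧) • toConj _ ((L.within P).toSubmodule.mkQ (f x)) := by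
            rw [smul_toConj, evalNegHom_evalNegHom]
          rw [map_smul, map_smul, e1, map_smul, map_smul, smul_eq_mul, map_mul,
            evalNegHom_evalNegHom, RingHom.id_apply, smul_eq_mul]
          ring }
    obtain ⟨w, hw⟩ := h.exists_pairing F
    have hwx : ∀ x : P.toSubmodule, pairing Φ w x =
        Elem.series 0 (φ (toConj _ ((L.within P).toSubmodule.mkQ x))) := by
      intro x
      rw [h.symm x w, hw]
      change C ε * evalNegHom (C ε * evalNegHom (Elem.series 0
        (φ (toConj _ ((L.within P).toSubmodule.mkQ (f x)))))) = _
      rw [map_mul, evalNegHom_C, evalNegHom_evalNegHom, ← mul_assoc, h.C_mul_C, one_mul, hfP]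
    have hwP : w ∈ P.toSubmodule := by
      rw [hP, hwx ⟨e, heP⟩]
      have e0 : (L.within P).toSubmodule.mkQ ⟨e, heP⟩ = 0 :=
        (Submodule.Quotient.mk_eq_zero _).2 ((hL _).2 ⟨1, one_smul _ _⟩)
      rw [e0, map_zero, map_zero, map_zero]
    refine ⟨(L.within P).toSubmodule.mkQ ⟨w, hwP⟩, LinearMap.ext fun y => ?_⟩
    obtain ⟨y, rfl⟩ := (toConj _).surjective y
    obtain ⟨y, rfl⟩ := hp y
    rw [hΨ]
    exact (Elem.series 0).injective (hwx y)

/-- Simple-pole submodules of full rank pass to subquotients. -/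
theorem exists_lattice_subquotient [Module.Finite ℂ⟦X⟧ E] {P L : ABSubmodule E} (hP : P.IsNormal)
    {R : Submodule ℂ⟦X⟧ E} (hR : IsSimplePole R) {N : ℕ}
    (hN : ∀ x : E, (X ^ N : ℂ⟦X⟧) • x ∈ R) :
    ∃ R' : Submodule ℂ⟦X⟧ (Subquotient P L), IsSimplePole R' ∧
      ∀ x, (X ^ N : ℂ⟦X⟧) • x ∈ R' := by
  refine ⟨(R.comap P.toSubmodule.subtype).map (L.within P).toSubmodule.mkQ, ?_, fun x => ?_⟩
  · rintro _ ⟨y, hy, rfl⟩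
    obtain ⟨z, hzR, hz⟩ := hR y hy
    have hzP : z ∈ P.toSubmodule := (isNormal_iff P).1 hP z (hz ▸ P.a_mem y y.2)
    refine ⟨_, ⟨⟨z, hzP⟩, hzR, rfl⟩, ?_⟩
    change (L.within P).toSubmodule.mkQ (a y) = _
    rw [← map_smul]
    congr 1
    ext
    exact hz
  · obtain ⟨y, rfl⟩ := (L.within P).toSubmodule.mkQ_surjective x
    exact ⟨(X ^ N : ℂ⟦X⟧) • y, hN y, map_smul _ _ _⟩

end Descent

/-! ### Construction of the series -/

section Series

universe u

variable {E : Type u} [AddCommGroup E] [Module ℂ⟦X⟧ E] [ABStructure E]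

theorem isNormal_fullSub [Module.Finite ℂ⟦X⟧ E] : (fullSub E).IsNormal :=
  (isNormal_iff _).2 fun _ _ => Submodule.mem_top

theorem isNormal_zeroSub [Module.Free ℂ⟦X⟧ E] [Module.Finite ℂ⟦X⟧ E] : (zeroSub E).IsNormal :=
  (isNormal_iff _).2 fun x hx => by
    change (X : ℂ⟦X⟧) • x = 0 at hx
    exact X_smul_injective (hx.trans (smul_zero _).symm)

namespace IsSignedForm

variable {Φ : E →ₗ[ℂ⟦X⟧] Conj E →ₗ[ℂ⟦X⟧] Elem 0} {ε : ℂ} (h : IsSignedForm ε Φ)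
include h

theorem exists_series_of_subsingleton [Module.Finite ℂ⟦X⟧ E] [Subsingleton E] :
    ∃ s : JHSeries E 0, s.IsSelfAdjoint := by
  refine ⟨
    { F := fun _ => fullSub E
      param := Fin.elim0
      bot := Subsingleton.elim _ _
      top := rfl
      lt := fun j => j.elim0
      normal := fun _ => isNormal_fullSub
      quotient := fun j => j.elim0 }, fun j => j.elim0, fun _ _ => ?_⟩
  refine IsSelfAdjoint.of_isIso ?_ h.isSelfAdjoint
  exact isIso_subquotient (fullSub E).toSubmodule.subtype (fun x => ⟨⟨x, trivial⟩, rfl⟩)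
    (fun _ => rfl) (fun _ => ⟨fun _ => trivial, fun _ => Subsingleton.elim _ _⟩)

/-- In rank one `E` is generated by an eigenvector `e`, and `Φ(e,e)` is a unit solving
`b S' = 2 l S`, so that the parameter `l` is `0`. -/
theorem isIso_elem_zero_of_finrank_eq_one [Module.Free ℂ⟦X⟧ E] [Module.Finite ℂ⟦X⟧ E]
    {R : Submodule ℂ⟦X⟧ E} (hR : IsSimplePole R) {N : ℕ}
    (hN : ∀ x : E, (X ^ N : ℂ⟦X⟧) • x ∈ R) (hrank : Module.finrank ℂ⟦X⟧ E = 1) :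
    IsIso E (Elem 0) := by
  have hE : Nontrivial E := Module.nontrivial_of_finrank_pos (R := ℂ⟦X⟧) (by omega)
  obtain ⟨y, hy⟩ := exists_ne (0 : E)
  have hR0 : R ≠ ⊥ := (Submodule.ne_bot_iff _).2 ⟨_, hN y, fun h0 =>
    hy (X_pow_smul_injective N (h0.trans (smul_zero _).symm))⟩
  obtain ⟨m, x, -, hx0, hx⟩ := hR.exists_eigenvector hR0
  obtain ⟨k, l, e, rfl, hprim, he⟩ := exists_primitive_eigenvector hx hx0
  have he0 : e ≠ 0 := fun h0 => hprim 0 (by rw [h0, smul_zero])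
  have htop : (lineSub he).toSubmodule = ⊤ := by
    have : Module.Free ℂ⟦X⟧ (E ⧸ (lineSub he).toSubmodule) := isNormal_lineSub he hprim
    have e1 := Submodule.finrank_quotient_add_finrank (lineSub he).toSubmodule
    rw [finrank_lineSub he he0, hrank] at e1
    rw [← Submodule.Quotient.subsingleton_iff]
    exact (Module.finrank_eq_zero_iff_of_free ℂ⟦X⟧ _).1 (by omega)
  obtain ⟨v, hv⟩ := h.exists_pairing_eq_one hprim
  obtain ⟨s, rfl⟩ : ∃ s : ℂ⟦X⟧, s • e = v := (mem_lineSub he).1 (htop ▸ Submodule.mem_top)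
  rw [pairing_smul_left] at hv
  have hl : l = 0 := by
    have e1 := congrArg PowerSeries.constantCoeff (h.derivative_pairing_self he)
    have e2 := congrArg PowerSeries.constantCoeff hv
    simp only [map_mul, PowerSeries.constantCoeff_X, zero_mul, PowerSeries.constantCoeff_C,
      map_one] at e1 e2
    have e3 := right_ne_zero_of_mul (e2.trans_ne one_ne_zero)
    simpa [e3] using e1.symm
  subst hl
  have hfull : lineSub he = fullSub E := ABSubmodule.ext_toSubmodule htop
  have hiso := isIso_lineSub he he0
  rw [hfull] at hiso
  exact isIso_fullSub_zeroSub.symm.trans hiso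

theorem exists_series_of_isIso_elem_zero [Module.Free ℂ⟦X⟧ E] [Module.Finite ℂ⟦X⟧ E]
    [Nontrivial E] (hE : IsIso E (Elem 0)) : ∃ s : JHSeries E 1, s.IsSelfAdjoint := by
  refine ⟨
    { F := ![zeroSub E, fullSub E]
      param := fun _ => 0
      bot := rfl
      top := rfl
      lt := fun j => by
        obtain rfl := Subsingleton.elim j 0
        exact bot_lt_top
      normal := fun j => ?_
      quotient := fun j => by
        obtain rfl := Subsingleton.elim j 0
        exact isIso_fullSub_zeroSub.trans hE }, fun j => neg_zero.symm, fun j hj => ?_⟩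
  · refine Fin.cases ?_ (fun i => ?_) j
    · exact isNormal_zeroSub
    · obtain rfl := Subsingleton.elim i 0
      exact isNormal_fullSub
  · obtain rfl : j = 0 := Fin.ext (by simpa using hj)
    exact IsSelfAdjoint.of_isIso isIso_fullSub_zeroSub h.isSelfAdjoint

/-- A self-adjoint series of `P / L`, where `L` is a normal line with parameter `l` and `E / P` has
parameter `-l`, extends to `E` by `0` and `E`. -/
theorem exists_series_of_subquotient [Module.Free ℂ⟦X⟧ E] [Module.Finite ℂ⟦X⟧ E]
    {P L : ABSubmodule E} (hP : P.IsNormal) (hLP : L.toSubmodule ≤ P.toSubmodule)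
    (hL0 : L.toSubmodule ≠ ⊥) (hP1 : P.toSubmodule ≠ ⊤) {l : ℂ}
    (hLl : IsIso (Subquotient L (zeroSub E)) (Elem l))
    (hPl : IsIso (Subquotient (fullSub E) P) (Elem (-l))) {n : ℕ}
    (s : JHSeries (Subquotient P L) n) (hs : s.IsSelfAdjoint) :
    ∃ s : JHSeries E (n + 2), s.IsSelfAdjoint := by
  have h0 : liftSub (s.F 0) = L := ABSubmodule.ext_toSubmodule (liftSub_eq_right hLP s.bot)
  have h1 : liftSub (s.F (Fin.last n)) = P := ABSubmodule.ext_toSubmodule (liftSub_eq_left s.top)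
  let G : Fin (n + 2) → ABSubmodule E :=
    Fin.snoc (α := fun _ => ABSubmodule E) (fun i => liftSub (s.F i)) (fullSub E)
  let F : Fin (n + 3) → ABSubmodule E := Fin.cons (α := fun _ => ABSubmodule E) (zeroSub E) G
  let q : Fin (n + 1) → ℂ := Fin.snoc (α := fun _ => ℂ) s.param (-l)
  let p : Fin (n + 2) → ℂ := Fin.cons (α := fun _ => ℂ) l q
  have F0 : F 0 = zeroSub E := rfl
  have FG : ∀ i, F (Fin.succ i) = G i := fun i => rfl
  have Glast : G (Fin.last (n + 1)) = fullSub E := Fin.snoc_last _ _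
  have Gcast : ∀ i, G (Fin.castSucc i) = liftSub (s.F i) := fun i => Fin.snoc_castSucc _ _ _
  have G0 : G 0 = L := (Gcast 0).trans h0
  have p0 : p 0 = l := rfl
  have pq : ∀ i, p (Fin.succ i) = q i := fun i => rfl
  have qlast : q (Fin.last n) = -l := Fin.snoc_last _ _
  have qcast : ∀ i, q (Fin.castSucc i) = s.param i := fun i => Fin.snoc_castSucc _ _ _
  refine ⟨
    { F := F
      param := p
      bot := rfl
      top := ?_
      lt := fun j => ?_
      normal := fun j => ?_
      quotient := fun j => ?_ }, fun j => ?_, fun j hj => ?_⟩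
  · rw [← Fin.succ_last, FG, Glast]
    rfl
  · refine Fin.cases ?_ (fun i => ?_) j
    · rw [FG, G0, Fin.castSucc_zero, F0]
      exact bot_lt_iff_ne_bot.2 hL0
    · rw [← Fin.succ_castSucc, FG, FG]
      refine Fin.lastCases ?_ (fun i => ?_) i
      · rw [Fin.succ_last, Glast, Gcast, h1]
        exact lt_top_iff_ne_top.2 hP1
      · rw [Fin.succ_castSucc, Gcast, Gcast]
        exact liftSub_lt_liftSub (s.lt i)
  · refine Fin.cases ?_ (fun i => ?_) j
    · exact isNormal_zeroSub
    · rw [FG]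
      refine Fin.lastCases ?_ (fun i => ?_) i
      · rw [Glast]
        exact isNormal_fullSub
      · rw [Gcast]
        exact isNormal_liftSub (s.normal i) hP
  · refine Fin.cases ?_ (fun i => ?_) j
    · rw [FG, G0, Fin.castSucc_zero, F0, p0]
      exact hLl
    · rw [← Fin.succ_castSucc, FG, FG, pq]
      refine Fin.lastCases ?_ (fun i => ?_) i
      · rw [Fin.succ_last, Glast, Gcast, h1, qlast]
        exact hPl
      · rw [Fin.succ_castSucc, Gcast, Gcast, qcast]
        exact (isIso_subquotient_liftSub _ _).trans (s.quotient i)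
  · change p j.rev = -p j
    refine Fin.cases ?_ (fun i => ?_) j
    · rw [Fin.rev_zero, ← Fin.succ_last, pq, qlast, p0]
    · rw [Fin.rev_succ, pq]
      refine Fin.lastCases ?_ (fun i => ?_) i
      · rw [Fin.rev_last, Fin.castSucc_zero, p0, qlast, neg_neg]
      · rw [Fin.rev_castSucc, ← Fin.succ_castSucc, pq, qcast, qcast]
        exact hs.1 i
  · change IsSelfAdjoint (Subquotient (F j.rev) (F j))
    revert hj
    refine Fin.cases (fun _ => ?_) (fun i => ?_) j
    · rw [Fin.rev_zero, ← Fin.succ_last, FG, Glast, F0]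
      exact IsSelfAdjoint.of_isIso isIso_fullSub_zeroSub h.isSelfAdjoint
    · refine Fin.lastCases (fun hj => ?_) (fun i hj => ?_) i
      · rw [Fin.val_succ, Fin.val_last] at hj
        omega
      · rw [Fin.rev_succ, Fin.rev_castSucc, ← Fin.succ_castSucc, FG, FG, Gcast, Gcast]
        rw [Fin.val_succ, Fin.val_castSucc] at hj
        exact IsSelfAdjoint.of_isIso (isIso_subquotient_liftSub _ _) (hs.2 i (by omega))

end IsSignedForm

/-- Reduction by isotropic lines, two ranks at a time. -/
theorem exists_series_of_isSignedForm (n : ℕ) : ∀ (E : Type u) [AddCommGroup E] [Module ℂ⟦X⟧ E]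
    [ABStructure E] [Module.Free ℂ⟦X⟧ E] [Module.Finite ℂ⟦X⟧ E] (R : Submodule ℂ⟦X⟧ E) (N : ℕ)
    (ε : ℂ) (Φ : E →ₗ[ℂ⟦X⟧] Conj E →ₗ[ℂ⟦X⟧] Elem 0), IsSimplePole R →
    (∀ x : E, (X ^ N : ℂ⟦X⟧) • x ∈ R) → IsSignedForm ε Φ → Module.finrank ℂ⟦X⟧ E = n →
    ∃ s : JHSeries E n, s.IsSelfAdjoint := by
  induction n using Nat.twoStepInduction with
  | zero =>
    intro E _ _ _ _ _ R N ε Φ hR hN h hrank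
    have : Subsingleton E := (Module.finrank_eq_zero_iff_of_free ℂ⟦X⟧ E).1 hrank
    exact h.exists_series_of_subsingleton
  | one =>
    intro E _ _ _ _ _ R N ε Φ hR hN h hrank
    have : Nontrivial E := Module.nontrivial_of_finrank_pos (R := ℂ⟦X⟧) (by omega)
    exact h.exists_series_of_isIso_elem_zero (h.isIso_elem_zero_of_finrank_eq_one hR hN hrank)
  | more n ih _ =>
    intro E _ _ _ _ _ R N ε Φ hR hN h hrank
    obtain ⟨l, e, he, hprim, hee⟩ := h.exists_primitive_isotropic hR hN (by omega)
    obtain ⟨v, hv⟩ := h.exists_pairing_eq_one hprim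
    have he0 : e ≠ 0 := fun h0 => hprim 0 (by rw [h0, smul_zero])
    have hP := isNormal_orthSub h.bilinear he
    have hLP : (lineSub he).toSubmodule ≤ (orthSub h.bilinear he).toSubmodule :=
      (Submodule.span_singleton_le_iff_mem _ _).2 hee
    obtain ⟨Ψ, hΨ⟩ := h.exists_reduction (fun x => mem_orthSub h.bilinear he)
      (fun x => mem_lineSub he) hee hv
    obtain ⟨R', hR', hN'⟩ := exists_lattice_subquotient (L := lineSub he) hP hR hN
    have hfree := free_subquotient (P := orthSub h.bilinear he) (isNormal_lineSub he hprim)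
    have hrank' : Module.finrank ℂ⟦X⟧
        (Subquotient (orthSub h.bilinear he) (lineSub he)) = n := by
      have e1 : Module.finrank ℂ⟦X⟧ (Subquotient (orthSub h.bilinear he) (lineSub he)) +
          Module.finrank ℂ⟦X⟧ ((lineSub he).within (orthSub h.bilinear he)).toSubmodule =
          Module.finrank ℂ⟦X⟧ (orthSub h.bilinear he).toSubmodule :=
        Submodule.finrank_quotient_add_finrank _
      have e2 := finrank_orthSub h.bilinear he hv
      have e3 := finrank_lineSub he he0
      have e4 : Module.finrank ℂ⟦X⟧
          ((lineSub he).within (orthSub h.bilinear he)).toSubmodule = 1 :=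
        (finrank_submoduleOf hLP).trans e3
      omega
    obtain ⟨s, hs⟩ := ih _ R' N ε Ψ hR' hN' hΨ hrank'
    refine h.exists_series_of_subquotient hP hLP ?_ ?_ (isIso_lineSub he he0)
      (isIso_quotient_orthSub h.bilinear he hv) s hs
    · exact (Submodule.ne_bot_iff _).2 ⟨e, (mem_lineSub he).2 ⟨1, one_smul _ _⟩, he0⟩
    · intro htop
      have hvP : v ∈ (orthSub h.bilinear he).toSubmodule := htop ▸ Submodule.mem_top
      rw [mem_orthSub, hv] at hvP
      exact one_ne_zero hvP

end Series

end AB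

theorem theorem1 {E : Type*} [AddCommGroup E] [Module ℂ⟦X⟧ E] [Module.Free ℂ⟦X⟧ E]
    [Module.Finite ℂ⟦X⟧ E] [AB.ABStructure E] (hreg : AB.IsRegular E) :
    (AB.IsHermitian E →
      ∃ s : AB.JHSeries E (Module.finrank ℂ⟦X⟧ E), s.IsSelfAdjoint) ∧
    (AB.IsAntiHermitian E →
      ∃ s : AB.JHSeries E (Module.finrank ℂ⟦X⟧ E), s.IsSelfAdjoint) := by
  obtain ⟨R, hR, N, hN⟩ := hreg.exists_lattice
  constructor
  · rintro ⟨Φ, ⟨hΦ, hsymm⟩, hnd⟩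
    refine AB.exists_series_of_isSignedForm _ E R N 1 Φ hR hN ⟨by norm_num, hΦ, ?_, hnd⟩ rfl
    intro v w
    rw [map_one, one_mul]
    exact hsymm v w
  · rintro ⟨Φ, ⟨hΦ, hsymm⟩, hnd⟩
    refine AB.exists_series_of_isSignedForm _ E R N (-1) Φ hR hN ⟨by norm_num, hΦ, ?_, hnd⟩ rfl
    intro v w
    rw [map_neg, map_one, neg_one_mul]
    exact hsymm v w
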